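/- **Setting.** Let $H_1,G_1$ be real Hilbert spaces, let $S_1\colon H_1\to G_1$ be a compact linear operator, and let $\lambda=(\lambda_m)_{m\in\mathbb N}$ be the sequence of the positive eigenvalues of $W_1=S_1^\dagger S_1$ in non-increasing order, repeated according to multiplicity and extended by zeros if there are only finitely many. For $d\in\mathbb N=\{1,2,\dots\}$ let $H_d=H_1\otimes\dots\otimes H_1$ and $G_d=G_1\otimes\dots\otimes G_1$ ($d$ factors) be the Hilbert space tensor powers and $S_d=S_1\otimes\dots\otimes S_1\colon H_d\to G_d$. Let $I_d\subseteq\{1,\dots,d\}$, with $I_d\neq\emptyset$ for $d>1$, let $\mathcal S_{I_d}$ be the group of all permutations of $\{1,\dots,d\}$ that fix every element outside $I_d$, and let $\mathfrak S_{I_d}(H_d)$ be the range of the symmetrizer, i.e. of the bounded linear operator on $H_d$ determined by $$f_1\otimes\dots\otimes f_d\;\mapsto\;\frac1{\#\mathcal S_{I_d}}\sum_{\pi\in\mathcal S_{I_d}} f_{\pi(1)}\otimes\dots\otimes f_{\pi(d)} .$$ Let $S_{d,I_d}$ be the restriction of $S_d$ to $\mathfrak S_{I_d}(H_d)$, and let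 $S_I=(S_{d,I_d})_{d\in\mathbb N}$. For $\varepsilon>0$ let $n(\varepsilon,d)$ be the information complexity in the worst case setting with respect to the absolute error criterion, that is, the least $n\in\mathbb N_0$ for which there are continuous linear functionals $L_1,\dots,L_n$ on $\mathfrak S_{I_d}(H_d)$ and $g_1,\dots,g_n\in G_d$ such that $$\sup_{f\in\mathfrak S_{I_d}(H_d),\ \|f\|\le 1}\ \Big\|S_{d,I_d}f-\sum_{j=1}^n L_j(f)\,g_j\Big\|\le\varepsilon .$$ $S_I$ is called *polynomially tractable* if there are constants $C,p>0$ and $q\ge0$ such that $n(\varepsilon,d)\le C\,\varepsilon^{-p}\,d^{\,q}$ for all $d\in\mathbb N$ and $\varepsilon\in(0,1]$, and *strongly polynomially tractable* if this holds with $q=0$. **Theorem 5.11.** Assume $\lambda_2>0$. Then $S_I$ is strongly polynomially tractable if and only if $\lambda\in\ell_\tau$ for some $\tau\in(0,\infty)$ and * $\lambda_1<1$, or * $1=\lambda_1>\lambda_2$ and $(d-\#I_d)\in O(1)$ as $d\to\infty$. Moreover, provided that $\lambda_1\le1$, the problem $S_I$ is polynomially tractable if and only if $\lambda\in\ell_\tau$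 for some $\tau\in(0,\infty)$ and * $\lambda_1<1$, or * $\lambda_1=1$ and $(d-\#I_d)\in O(\ln d)$ as $d\to\infty$. -/

import Mathlib

open Filter Asymptotics
open scoped ENNReal

noncomputable section

/-! ### Hilbert tensor powers

The `d`-fold tensor power of a real Hilbert space `H`: the algebraic tensor power with the inner
product `⟪⨂ f k, ⨂ g k⟫ = ∏ ⟪f k, g k⟫`, completed. -/

/-- The algebraic `d`-fold tensor power of `H`. (A copy of `PiTensorProduct`, because Mathlib
already puts the projective norm on the latter.) -/
def AlgTensorPower (H : Type*) [NormedAddCommGroup H] [InnerProductSpace ℝ H] (d : ℕ) : Type _ :=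
  PiTensorProduct ℝ (fun _ : Fin d => H)

section TensorPower

variable {H G : Type*} [NormedAddCommGroup H] [InnerProductSpace ℝ H]
  [NormedAddCommGroup G] [InnerProductSpace ℝ G]

instance algTensorPowerAddCommGroup (d : ℕ) : AddCommGroup (AlgTensorPower H d) :=
  inferInstanceAs (AddCommGroup (PiTensorProduct ℝ (fun _ : Fin d => H)))

instance algTensorPowerModule (d : ℕ) : Module ℝ (AlgTensorPower H d) :=
  inferInstanceAs (Module ℝ (PiTensorProduct ℝ (fun _ : Fin d => H)))

namespace AlgTensorPower

/-- The simple tensor `f 0 ⊗ ⋯ ⊗ f (d-1)`, multilinear in `f`. -/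
def tmul (H : Type*) [NormedAddCommGroup H] [InnerProductSpace ℝ H] (d : ℕ) :
    MultilinearMap ℝ (fun _ : Fin d => H) (AlgTensorPower H d) :=
  PiTensorProduct.tprod ℝ

/-- The bilinear form with `⟪⨂ f k, ⨂ g k⟫ = ∏ ⟪f k, g k⟫`. -/
def innerForm (H : Type*) [NormedAddCommGroup H] [InnerProductSpace ℝ H] (d : ℕ) :
    AlgTensorPower H d →ₗ[ℝ] AlgTensorPower H d →ₗ[ℝ] ℝ :=
  (PiTensorProduct.map₂ (fun _ : Fin d => innerₗ H)).compr₂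
    (PiTensorProduct.lift (MultilinearMap.mkPiAlgebra ℝ (Fin d) ℝ))

theorem innerForm_tmul {d : ℕ} (f g : Fin d → H) :
    innerForm H d (tmul H d f) (tmul H d g) = ∏ k, inner ℝ (f k) (g k) := by
  change PiTensorProduct.lift (MultilinearMap.mkPiAlgebra ℝ (Fin d) ℝ)
    (PiTensorProduct.map₂ (fun _ : Fin d => innerₗ H) (PiTensorProduct.tprod ℝ f)
      (PiTensorProduct.tprod ℝ g)) = _
  rw [PiTensorProduct.map₂_tprod_tprod, PiTensorProduct.lift.tprod]
  simp

theorem span_tmul (d : ℕ) : Submodule.span ℝ (Set.range (tmul H d)) = ⊤ :=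
  PiTensorProduct.span_tprod_eq_top

theorem exists_sum {d : ℕ} (x : AlgTensorPower H d) :
    ∃ (n : ℕ) (c : Fin n → ℝ) (f : Fin n → Fin d → H), x = ∑ i, c i • tmul H d (f i) := by
  have hx : x ∈ Submodule.span ℝ (Set.range (tmul H d)) := by rw [span_tmul]; trivial
  obtain ⟨n, c, g, hg⟩ := Submodule.mem_span_set'.1 hx
  choose f hf using fun i => (g i).2
  exact ⟨n, c, f, by rw [← hg]; simp only [hf]⟩

theorem innerForm_comm {d : ℕ} (x y : AlgTensorPower H d) :
    innerForm H d x y = innerForm H d y x := by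
  obtain ⟨n, c, f, rfl⟩ := exists_sum x
  obtain ⟨m, b, g, rfl⟩ := exists_sum y
  simp only [map_sum, map_smul, LinearMap.sum_apply, LinearMap.smul_apply, innerForm_tmul,
    smul_eq_mul, Finset.mul_sum]
  rw [Finset.sum_comm]
  refine Finset.sum_congr rfl fun i _ => Finset.sum_congr rfl fun j _ => ?_
  simp only [real_inner_comm]
  ring

theorem innerForm_sum_self {d n : ℕ} (c : Fin n → ℝ) (f : Fin n → Fin d → H) :
    innerForm H d (∑ i, c i • tmul H d (f i)) (∑ i, c i • tmul H d (f i)) =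
      ∑ i, ∑ j, c i * (∏ k, inner ℝ (f i k) (f j k)) * c j := by
  simp only [map_sum, map_smul, LinearMap.sum_apply, LinearMap.smul_apply, innerForm_tmul,
    smul_eq_mul, Finset.mul_sum]
  rw [Finset.sum_comm]
  exact Finset.sum_congr rfl fun i _ => Finset.sum_congr rfl fun j _ => by ring

/-- Entrywise products respect the order `0 ≤ B ≤ A` of positive semidefinite matrices. -/
theorem posSemidef_prod {n : ℕ} {κ : Type*} (s : Finset κ) (A B : κ → Matrix (Fin n) (Fin n) ℝ)
    (hB : ∀ k, (B k).PosSemidef) (hAB : ∀ k, (A k - B k).PosSemidef) :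
    (Matrix.of fun i j => ∏ k ∈ s, B k i j).PosSemidef ∧
      (Matrix.of fun i j => ∏ k ∈ s, A k i j - ∏ k ∈ s, B k i j).PosSemidef := by
  classical
  induction s using Finset.induction_on with
  | empty =>
    constructor
    · have h := Matrix.posSemidef_vecMulVec_self_star (R := ℝ) (fun _ : Fin n => (1 : ℝ))
      convert h using 1
      ext i j
      simp [Matrix.vecMulVec_apply]
    · convert Matrix.PosSemidef.zero (n := Fin n) (R := ℝ) using 1
      ext i j
      simp
  | insert a s ha ih =>
    have hA : (A a).PosSemidef := by simpa using (hAB a).add (hB a)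
    constructor
    · have e : (Matrix.of fun i j => ∏ k ∈ insert a s, B k i j) =
          (B a).hadamard (Matrix.of fun i j => ∏ k ∈ s, B k i j) := by
        ext i j
        simp [Finset.prod_insert ha]
      rw [e]
      exact (hB a).hadamard ih.1
    · have e : (Matrix.of fun i j => ∏ k ∈ insert a s, A k i j - ∏ k ∈ insert a s, B k i j) =
          (A a).hadamard (Matrix.of fun i j => ∏ k ∈ s, A k i j - ∏ k ∈ s, B k i j) +
            (A a - B a).hadamard (Matrix.of fun i j => ∏ k ∈ s, B k i j) := by
        ext i j
        simp [Finset.prod_insert ha]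
        ring
      rw [e]
      exact Matrix.PosSemidef.add (hA.hadamard ih.2) ((hAB a).hadamard ih.1)

theorem posSemidef_sum_nonneg {n : ℕ} {M : Matrix (Fin n) (Fin n) ℝ} (hM : M.PosSemidef)
    (c : Fin n → ℝ) : 0 ≤ ∑ i, ∑ j, c i * M i j * c j := by
  have h := hM.dotProduct_mulVec_nonneg c
  simpa [dotProduct, Matrix.mulVec, Finset.mul_sum, mul_assoc] using h

theorem posSemidef_of_sum {n : ℕ} {M : Matrix (Fin n) (Fin n) ℝ} (hs : ∀ i j, M i j = M j i)
    (h : ∀ c : Fin n → ℝ, 0 ≤ ∑ i, ∑ j, c i * M i j * c j) : M.PosSemidef := by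
  rw [Matrix.posSemidef_iff_dotProduct_mulVec]
  refine ⟨?_, fun c => ?_⟩
  · ext i j
    simp [hs i j]
  · simpa [dotProduct, Matrix.mulVec, Finset.mul_sum, mul_assoc] using h c

theorem sum_inner_eq {n : ℕ} (c : Fin n → ℝ) (v : Fin n → H) :
    ∑ i, ∑ j, c i * inner ℝ (v i) (v j) * c j = ‖∑ i, c i • v i‖ ^ 2 := by
  rw [← real_inner_self_eq_norm_sq, sum_inner]
  simp only [inner_sum, real_inner_smul_left, real_inner_smul_right]
  exact Finset.sum_congr rfl fun i _ => Finset.sum_congr rfl fun j _ => by ring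

theorem posSemidef_inner {n : ℕ} (v : Fin n → H) :
    (Matrix.of fun i j => (inner ℝ (v i) (v j) : ℝ)).PosSemidef :=
  posSemidef_of_sum (fun i j => by simp [real_inner_comm]) fun c => by
    simp only [Matrix.of_apply, sum_inner_eq]; positivity

theorem posSemidef_inner_sub (S : H →L[ℝ] G) {n : ℕ} (v : Fin n → H) :
    ((Matrix.of fun i j => ‖S‖ ^ 2 * (inner ℝ (v i) (v j) : ℝ)) -
      Matrix.of fun i j => (inner ℝ (S (v i)) (S (v j)) : ℝ)).PosSemidef := by
  refine posSemidef_of_sum (fun i j => by simp [real_inner_comm]) fun c => ?_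
  have h : ∑ i, ∑ j, c i * (((Matrix.of fun i j => ‖S‖ ^ 2 * (inner ℝ (v i) (v j) : ℝ)) -
      Matrix.of fun i j => (inner ℝ (S (v i)) (S (v j)) : ℝ)) i j) * c j =
      ‖S‖ ^ 2 * (∑ i, ∑ j, c i * inner ℝ (v i) (v j) * c j) -
        ∑ i, ∑ j, c i * inner ℝ (S (v i)) (S (v j)) * c j := by
    simp only [Finset.mul_sum, ← Finset.sum_sub_distrib]
    exact Finset.sum_congr rfl fun i _ => Finset.sum_congr rfl fun j _ => by simp; ring
  rw [h, sum_inner_eq, sum_inner_eq c (fun i => S (v i)), sub_nonneg, ← mul_pow]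
  have h2 : ∑ i, c i • S (v i) = S (∑ i, c i • v i) := by simp
  rw [h2]
  exact pow_le_pow_left₀ (norm_nonneg _) (S.le_opNorm _) 2

theorem innerForm_self_nonneg {d : ℕ} (x : AlgTensorPower H d) : 0 ≤ innerForm H d x x := by
  obtain ⟨n, c, f, rfl⟩ := exists_sum x
  rw [innerForm_sum_self]
  exact posSemidef_sum_nonneg (posSemidef_prod Finset.univ
    (fun k => Matrix.of fun i j => (inner ℝ (f i k) (f j k) : ℝ))
    (fun k => Matrix.of fun i j => (inner ℝ (f i k) (f j k) : ℝ))
    (fun k => posSemidef_inner fun i => f i k)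
    (fun k => by rw [sub_self]; exact Matrix.PosSemidef.zero)).1 c

/-- The inner product on the algebraic tensor power. -/
@[reducible] def core (H : Type*) [NormedAddCommGroup H] [InnerProductSpace ℝ H] (d : ℕ) :
    PreInnerProductSpace.Core ℝ (AlgTensorPower H d) where
  inner x y := innerForm H d x y
  conj_inner_symm x y := by simpa using innerForm_comm y x
  re_inner_nonneg x := by simpa using innerForm_self_nonneg x
  add_left x y z := by simp
  smul_left x y r := by simp

end AlgTensorPower

instance algTensorPowerSeminormed (d : ℕ) : SeminormedAddCommGroup (AlgTensorPower H d) :=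
  letI := AlgTensorPower.core H d
  InnerProductSpace.Core.toSeminormedAddCommGroup (𝕜 := ℝ)

instance algTensorPowerInner (d : ℕ) : InnerProductSpace ℝ (AlgTensorPower H d) :=
  InnerProductSpace.ofCore (AlgTensorPower.core H d)

namespace AlgTensorPower

theorem inner_eq {d : ℕ} (x y : AlgTensorPower H d) : inner ℝ x y = innerForm H d x y := rfl

/-- The linear map `⨂ f k ↦ ⨂ S (f k)`. -/
def mapₗ (S : H →L[ℝ] G) (d : ℕ) : AlgTensorPower H d →ₗ[ℝ] AlgTensorPower G d :=
  PiTensorProduct.map fun _ : Fin d => (S : H →ₗ[ℝ] G)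

theorem mapₗ_tmul (S : H →L[ℝ] G) {d : ℕ} (f : Fin d → H) :
    mapₗ S d (tmul H d f) = tmul G d (fun k => S (f k)) :=
  PiTensorProduct.map_tprod _ _

theorem norm_mapₗ_le (S : H →L[ℝ] G) {d : ℕ} (x : AlgTensorPower H d) :
    ‖mapₗ S d x‖ ≤ ‖S‖ ^ d * ‖x‖ := by
  refine le_of_sq_le_sq ?_ (by positivity)
  rw [mul_pow, ← real_inner_self_eq_norm_sq, ← real_inner_self_eq_norm_sq, inner_eq, inner_eq]
  obtain ⟨n, c, f, rfl⟩ := exists_sum x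
  have h := posSemidef_sum_nonneg (posSemidef_prod Finset.univ
    (fun k : Fin d => Matrix.of fun i j => ‖S‖ ^ 2 * (inner ℝ (f i k) (f j k) : ℝ))
    (fun k => Matrix.of fun i j => (inner ℝ (S (f i k)) (S (f j k)) : ℝ))
    (fun k => posSemidef_inner fun i => S (f i k))
    (fun k => posSemidef_inner_sub S fun i => f i k)).2 c
  have e : mapₗ S d (∑ i, c i • tmul H d (f i)) = ∑ i, c i • tmul G d (fun k => S (f i k)) := by
    rw [map_sum]
    exact Finset.sum_congr rfl fun i _ => by rw [map_smul, mapₗ_tmul]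
  rw [e, innerForm_sum_self, innerForm_sum_self, ← sub_nonneg]
  refine h.trans_eq ?_
  rw [Finset.mul_sum, ← Finset.sum_sub_distrib]
  refine Finset.sum_congr rfl fun i _ => ?_
  rw [Finset.mul_sum, ← Finset.sum_sub_distrib]
  refine Finset.sum_congr rfl fun j _ => ?_
  simp [Finset.prod_mul_distrib]
  ring

/-- The bounded operator `⨂ f k ↦ ⨂ S (f k)` on the algebraic tensor power. -/
def mapL (S : H →L[ℝ] G) (d : ℕ) : AlgTensorPower H d →L[ℝ] AlgTensorPower G d :=
  (mapₗ S d).mkContinuous (‖S‖ ^ d) (norm_mapₗ_le S)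

/-- The linear map `⨂ f k ↦ ⨂ f (π k)`. -/
def permₗ {d : ℕ} (π : Equiv.Perm (Fin d)) : AlgTensorPower H d →ₗ[ℝ] AlgTensorPower H d :=
  PiTensorProduct.lift ((tmul H d).domDomCongr π)

theorem permₗ_tmul {d : ℕ} (π : Equiv.Perm (Fin d)) (f : Fin d → H) :
    permₗ π (tmul H d f) = tmul H d (fun k => f (π k)) :=
  PiTensorProduct.lift.tprod _

theorem norm_permₗ_le {d : ℕ} (π : Equiv.Perm (Fin d)) (x : AlgTensorPower H d) :
    ‖permₗ π x‖ ≤ 1 * ‖x‖ := by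
  refine le_of_sq_le_sq (le_of_eq ?_) (by positivity)
  rw [one_mul, ← real_inner_self_eq_norm_sq, ← real_inner_self_eq_norm_sq, inner_eq, inner_eq]
  obtain ⟨n, c, f, rfl⟩ := exists_sum x
  have e : permₗ π (∑ i, c i • tmul H d (f i)) = ∑ i, c i • tmul H d (fun k => f i (π k)) := by
    rw [map_sum]
    exact Finset.sum_congr rfl fun i _ => by rw [map_smul, permₗ_tmul]
  rw [e, innerForm_sum_self, innerForm_sum_self]
  refine Finset.sum_congr rfl fun i _ => Finset.sum_congr rfl fun j _ => ?_
  rw [Equiv.prod_comp π (fun k => (inner ℝ (f i k) (f j k) : ℝ))]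

/-- The bounded operator `⨂ f k ↦ ⨂ f (π k)` on the algebraic tensor power. -/
def permL {d : ℕ} (π : Equiv.Perm (Fin d)) : AlgTensorPower H d →L[ℝ] AlgTensorPower H d :=
  (permₗ π).mkContinuous 1 (norm_permₗ_le π)

end AlgTensorPower

/-- The Hilbert space `H ⊗ ⋯ ⊗ H` (`d` factors). -/
abbrev HilbertTensorPower (H : Type*) [NormedAddCommGroup H] [InnerProductSpace ℝ H] (d : ℕ) :
    Type _ :=
  UniformSpace.Completion (AlgTensorPower H d)

namespace HilbertTensorPower

/-- The simple tensor `f 0 ⊗ ⋯ ⊗ f (d-1)`. -/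
def tmul {d : ℕ} (f : Fin d → H) : HilbertTensorPower H d :=
  (AlgTensorPower.tmul H d f : AlgTensorPower H d)

theorem inner_tmul {d : ℕ} (f g : Fin d → H) :
    inner ℝ (tmul f) (tmul g) = ∏ k, (inner ℝ (f k) (g k) : ℝ) := by
  rw [tmul, tmul, UniformSpace.Completion.inner_coe, AlgTensorPower.inner_eq,
    AlgTensorPower.innerForm_tmul]

/-- Continuous extension of an operator from the algebraic tensor powers to the completions. -/
def extend {d e : ℕ} (T : AlgTensorPower H d →L[ℝ] AlgTensorPower G e) :
    HilbertTensorPower H d →L[ℝ] HilbertTensorPower G e :=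
  ((UniformSpace.Completion.toComplL (𝕜 := ℝ)).comp T).extend
    (UniformSpace.Completion.toComplL (𝕜 := ℝ))

theorem extend_coe {d e : ℕ} (T : AlgTensorPower H d →L[ℝ] AlgTensorPower G e)
    (x : AlgTensorPower H d) :
    extend T (x : HilbertTensorPower H d) = (T x : HilbertTensorPower G e) :=
  ContinuousLinearMap.extend_eq _ UniformSpace.Completion.denseRange_coe
    (UniformSpace.Completion.isUniformInducing_coe _) x

/-- The tensor power `S ⊗ ⋯ ⊗ S` of a bounded operator. -/
def map (S : H →L[ℝ] G) (d : ℕ) : HilbertTensorPower H d →L[ℝ] HilbertTensorPower G d :=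
  extend (AlgTensorPower.mapL S d)

theorem map_tmul (S : H →L[ℝ] G) {d : ℕ} (f : Fin d → H) :
    map S d (tmul f) = tmul (fun k => S (f k)) := by
  rw [map, tmul, extend_coe]
  exact congrArg _ (AlgTensorPower.mapₗ_tmul S f)

/-- Permutation of the tensor factors, `⨂ f k ↦ ⨂ f (π k)`. -/
def perm {d : ℕ} (π : Equiv.Perm (Fin d)) : HilbertTensorPower H d →L[ℝ] HilbertTensorPower H d :=
  extend (AlgTensorPower.permL π)

theorem perm_tmul {d : ℕ} (π : Equiv.Perm (Fin d)) (f : Fin d → H) :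
    perm π (tmul f) = tmul (fun k => f (π k)) := by
  rw [perm, tmul, extend_coe]
  exact congrArg _ (AlgTensorPower.permₗ_tmul π f)

end HilbertTensorPower

/-! ### Symmetric subspaces -/

/-- The permutations of the coordinates that leave the complement of `I` fixed. -/
def coordPerms {d : ℕ} (I : Finset (Fin d)) : Finset (Equiv.Perm (Fin d)) :=
  Finset.univ.filter fun π => ∀ i, i ∉ I → π i = i

/-- The symmetrizer with respect to `I`: the average of all `perm π`, `π ∈ coordPerms I`. -/
def symmetrizer (H : Type*) [NormedAddCommGroup H] [InnerProductSpace ℝ H] {d : ℕ}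
    (I : Finset (Fin d)) : HilbertTensorPower H d →L[ℝ] HilbertTensorPower H d :=
  ((coordPerms I).card : ℝ)⁻¹ • ∑ π ∈ coordPerms I, HilbertTensorPower.perm π

/-- The subspace of `I`-symmetric elements: the range of the symmetrizer. -/
def symmetricSubspace (H : Type*) [NormedAddCommGroup H] [InnerProductSpace ℝ H] {d : ℕ}
    (I : Finset (Fin d)) : Submodule ℝ (HilbertTensorPower H d) :=
  LinearMap.range (symmetrizer H I : HilbertTensorPower H d →ₗ[ℝ] HilbertTensorPower H d)

/-- The tensor power `S ⊗ ⋯ ⊗ S` restricted to the `I`-symmetric elements. -/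
def symmetricProblem (S : H →L[ℝ] G) {d : ℕ} (I : Finset (Fin d)) :
    symmetricSubspace H I →L[ℝ] HilbertTensorPower G d :=
  (HilbertTensorPower.map S d).comp (symmetricSubspace H I).subtypeL

end TensorPower

/-! ### Information complexity and tractability -/

section Complexity

variable {F G : Type*} [NormedAddCommGroup F] [NormedSpace ℝ F]
  [NormedAddCommGroup G] [NormedSpace ℝ G]

/-- The linear algorithms `f ↦ ∑ L j f • g j` that use `n` continuous linear functionals. -/
def linearAlgorithms (F G : Type*) [NormedAddCommGroup F] [NormedSpace ℝ F]
    [NormedAddCommGroup G] [NormedSpace ℝ G] (n : ℕ) : Set (F → G) :=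
  {A | ∃ (L : Fin n → F →L[ℝ] ℝ) (g : Fin n → G), ∀ f, A f = ∑ j, L j f • g j}

/-- The worst case error of `A` as an approximation of `S` on the closed unit ball. -/
def worstCaseError (S A : F → G) : ℝ≥0∞ :=
  ⨆ f ∈ Metric.closedBall (0 : F) 1, ‖S f - A f‖ₑ

/-- The information complexity for absolute errors: the least `n` such that some linear algorithm
with `n` functionals has worst case error at most `ε` (`⊤` if there is no such `n`). -/
def infoComplexity (S : F →L[ℝ] G) (ε : ℝ) : ℕ∞ :=
  ⨅ (n : ℕ) (_ : ∃ A ∈ linearAlgorithms F G n, worstCaseError S A ≤ ENNReal.ofReal ε), (n : ℕ∞)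

end Complexity

/-- `N ε d ≤ C * ε ^ (-p) * d ^ q` for all `d ≥ 1` and `ε ∈ (0, 1]` (in particular, finite). -/
def TractabilityBound (N : ℝ → ℕ → ℕ∞) (C p q : ℝ) : Prop :=
  ∀ d : ℕ, 1 ≤ d → ∀ ε : ℝ, 0 < ε → ε ≤ 1 →
    ∃ n : ℕ, N ε d = n ∧ (n : ℝ) ≤ C * ε ^ (-p) * (d : ℝ) ^ q

/-- Polynomial tractability of a problem with information complexity `N ε d`. -/
def PolynomiallyTractable (N : ℝ → ℕ → ℕ∞) : Prop :=
  ∃ C p q : ℝ, 0 < C ∧ 0 < p ∧ 0 ≤ q ∧ TractabilityBound N C p q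

/-- Strong polynomial tractability: polynomial tractability with `q = 0`. -/
def StronglyPolynomiallyTractable (N : ℝ → ℕ → ℕ∞) : Prop :=
  ∃ C p : ℝ, 0 < C ∧ 0 < p ∧ TractabilityBound N C p 0

/-! ### Eigenvalue sequences -/

/-- `lam 0 ≥ lam 1 ≥ ⋯ ≥ 0` lists the positive eigenvalues of `W`, each repeated according to its
multiplicity, and is continued by zeros if there are only finitely many. -/
structure IsEigenvalueSequence {H : Type*} [NormedAddCommGroup H] [InnerProductSpace ℝ H]
    (W : H →L[ℝ] H) (lam : ℕ → ℝ) : Prop where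
  antitone : Antitone lam
  nonneg : ∀ m, 0 ≤ lam m
  multiplicity : ∀ μ : ℝ, 0 < μ → {m | lam m = μ}.encard =
    Module.finrank ℝ (Module.End.eigenspace (W : H →ₗ[ℝ] H) μ)

end

open Filter Asymptotics
open scoped ENNReal

/-! Let λ_0 ≥ λ_1 ≥ … be the values of `lam`. The singular vectors of `S` tensorize: symmetrizing
tensor products of them gives orthogonal vectors with orthogonal images, whose squared singular
values are the products ∏ λ_{j_k}. Hence n(ε, d) counts the index vectors j with ∏ λ_{j_k} > ε²,
modulo permutations of the coordinates in I. What remains is to estimate this count from both sides.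

Upper bound (`card_image_mul_le`, `prod_sum_pow_le`): a class is determined by the entries outside I
and by how often each value but one occurs on I. If λ_0 ≤ 1, Markov's inequality for the τ-th powers
bounds the count by ε^(-2τ) · A^(d-#I) · ∏_{m≥1} ∑_{t≤d} λ_m^(τt) with A = ∑ λ_m^τ. Each λ_m = 1
with m ≥ 1 contributes a factor d+1, and the other m together contribute a constant. So the free
coordinates cost A^(d-#I), which is polynomial in d if d-#I = O(ln d) and bounded if d-#I = O(1). If
λ_0 < 1, a large τ gives A ≤ 1 and the cost disappears.

Lower bounds: the case d = 1 forces λ ∈ ℓ_τ. Index vectors with entries in {0, 1} do the rest. Those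
with 0, 1, …, K ones are inequivalent for every I (`succ_le_infoComplexity`), which under strong
tractability excludes λ_0 > 1 and λ_0 = λ_1 = 1. Those with k ones, all outside I, number (d-#I
choose k) (`choose_le_infoComplexity`); weighting these bounds geometrically and summing over k
gives (1+x)^(d-#I) ≤ const · d^q for some x > 0, so d-#I is at most logarithmic, and bounded if q =
0. -/

noncomputable section

/-! ### Singular value decomposition of a compact operator. -/

section Spectral

universe u

variable {H : Type u} {G : Type*} [NormedAddCommGroup H] [InnerProductSpace ℝ H] [CompleteSpace H]
  [NormedAddCommGroup G] [InnerProductSpace ℝ G] [CompleteSpace G]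

open Module.End in
/-- Eigenvectors for the positive members of an eigenvalue sequence can be chosen such that they
form an orthonormal family which spans all eigenspaces of positive eigenvalues. -/
theorem IsEigenvalueSequence.exists_orthonormal {W : H →L[ℝ] H} (hW : IsCompactOperator W)
    (hW' : (W : H →ₗ[ℝ] H).IsSymmetric) {lam : ℕ → ℝ} (hlam : IsEigenvalueSequence W lam) :
    ∃ e : {m // 0 < lam m} → H, Orthonormal ℝ e ∧ (∀ m, W (e m) = lam m • e m) ∧
      ∀ μ, 0 < μ → eigenspace (W : H →ₗ[ℝ] H) μ ≤ Submodule.span ℝ (Set.range e) := by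
  have key : ∀ μ : {μ : ℝ // 0 < μ}, ∃ B : {m // lam m = μ} →
      eigenspace (W : H →ₗ[ℝ] H) (μ : ℝ), Orthonormal ℝ B ∧
        Submodule.span ℝ (Set.range B) = ⊤ := by
    rintro ⟨μ, hμ⟩
    have hfd := ContinuousLinearMap.finite_dimensional_eigenspace hW μ hμ.ne'
    have hc := hlam.multiplicity μ hμ
    have hfin : {m | lam m = μ}.Finite := by
      rw [← Set.encard_ne_top_iff, hc]; exact ENat.natCast_ne_top _
    have : Fintype {m // lam m = μ} := hfin.fintype
    have hcard : Nat.card {m // lam m = μ} =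
        Module.finrank ℝ (eigenspace (W : H →ₗ[ℝ] H) μ) := by
      have h1 := congrArg ENat.toNat hc
      rw [ENat.toNat_natCast] at h1
      exact h1
    let B := (stdOrthonormalBasis ℝ (eigenspace (W : H →ₗ[ℝ] H) μ)).reindex
      (Finite.equivFinOfCardEq hcard).symm
    exact ⟨B, B.orthonormal, by rw [← B.coe_toBasis]; exact B.toBasis.span_eq⟩
  choose B hB hspan using key
  let e : {m // 0 < lam m} → H := fun m => B ⟨lam m, m.2⟩ ⟨m, rfl⟩
  have he : ∀ m : {m // 0 < lam m}, e m ∈ eigenspace (W : H →ₗ[ℝ] H) (lam m) := fun m =>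
    (B ⟨lam m, m.2⟩ ⟨m, rfl⟩).2
  -- Members with equal eigenvalues have to be seen inside one and the same basis before its
  -- orthonormality applies.
  have heq : ∀ (μ : {μ : ℝ // 0 < μ}) (m : {m // 0 < lam m}) (h : lam m = μ),
      e m = B μ ⟨m, h⟩ := by
    rintro ⟨μ, hμ⟩ m h
    simp only at h
    subst h
    rfl
  refine ⟨e, ⟨fun m => (hB ⟨lam m, m.2⟩).1 _, fun m n hmn => ?_⟩,
    fun m => mem_eigenspace_iff.1 (he m), fun μ hμ => ?_⟩
  · by_cases h : lam m = lam n
    · change inner ℝ (e m) (e n) = 0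
      rw [heq ⟨lam n, n.2⟩ m h]
      exact (hB ⟨lam n, n.2⟩).2 (i := ⟨m, h⟩) (j := ⟨n, rfl⟩) (fun h' => hmn (Subtype.ext
        (Subtype.mk.inj h')))
    · exact hW'.orthogonalFamily_eigenspaces h ⟨e m, he m⟩ ⟨e n, he n⟩
  · have h := congrArg (Submodule.map (eigenspace (W : H →ₗ[ℝ] H) μ).subtype) (hspan ⟨μ, hμ⟩)
    rw [Submodule.map_span, Submodule.map_top, Submodule.range_subtype] at h
    rw [← h]
    refine Submodule.span_mono ?_
    rintro _ ⟨_, ⟨m, rfl⟩, rfl⟩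
    exact ⟨⟨m, by rw [m.2]; exact hμ⟩, heq ⟨μ, hμ⟩ ⟨m, _⟩ m.2⟩

/-- The singular value decomposition of a compact operator: a Hilbert basis whose image is an
orthogonal family with squared norms `lam m` or `0`. -/
theorem IsEigenvalueSequence.exists_hilbertBasis {S : H →L[ℝ] G} (hS : IsCompactOperator S)
    {lam : ℕ → ℝ} (hlam : IsEigenvalueSequence ((ContinuousLinearMap.adjoint S).comp S) lam) :
    ∃ (κ : Type u) (b : HilbertBasis ({m // 0 < lam m} ⊕ κ) ℝ H), ∀ i x,
      inner ℝ (S x) (S (b i)) = Sum.elim (fun m => lam m.1) (fun _ => 0) i * inner ℝ x (b i) := by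
  set W := (ContinuousLinearMap.adjoint S).comp S with hWdef
  have hW : IsCompactOperator W := hS.clm_comp (ContinuousLinearMap.adjoint S)
  have hW' : (W : H →ₗ[ℝ] H).IsSymmetric := fun x y => by
    simp [hWdef, ContinuousLinearMap.adjoint_inner_left, ContinuousLinearMap.adjoint_inner_right]
  have hSS : ∀ x y, inner ℝ (S x) (S y) = inner ℝ x (W y) := fun x y => by
    simp [hWdef, ContinuousLinearMap.adjoint_inner_right]
  obtain ⟨e, he, heW, hspan⟩ := hlam.exists_orthonormal hW hW'
  -- The kernel may be infinite-dimensional; its Hilbert basis, indexed by `κ`, supplies the vectors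
  -- of weight `0`.
  let K : Submodule ℝ H := LinearMap.ker (W : H →ₗ[ℝ] H)
  have hK : IsClosed (K : Set H) := W.isClosed_ker
  have : CompleteSpace K := hK.completeSpace_coe
  obtain ⟨κ, c, -⟩ := _root_.exists_hilbertBasis ℝ K
  have hcW : ∀ k, W (c k) = 0 := fun k => (c k).2
  have hcross : ∀ m k, inner ℝ (e m) (c k : H) = 0 := fun m k => by
    have h := hW' (e m) (c k)
    simp only [ContinuousLinearMap.coe_coe, heW, hcW, inner_zero_right, real_inner_smul_left] at h
    exact (mul_eq_zero.1 h).resolve_left m.2.ne'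
  let v : {m // 0 < lam m} ⊕ κ → H := Sum.elim e (fun k => (c k : H))
  have hv : Orthonormal ℝ v := by
    refine ⟨?_, ?_⟩
    · rintro (m | k)
      · exact he.1 m
      · exact c.orthonormal.1 k
    · rintro (m | k) (n | l) h
      · exact he.2 (fun h' => h (by rw [h']))
      · exact hcross m l
      · exact (real_inner_comm _ _).trans (hcross n k)
      · exact c.orthonormal.2 (i := k) (j := l) (fun h' => h (by rw [h']))
  -- By the spectral theorem it suffices that a vector orthogonal to `v` is orthogonal to every
  -- eigenspace. Negative eigenvalues do not occur, as `W` is positive.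
  have htot : (Submodule.span ℝ (Set.range v))ᗮ = ⊥ := by
    rw [eq_bot_iff, ← ContinuousLinearMap.orthogonalComplement_iSup_eigenspaces_eq_bot hW hW']
    intro x hx
    have hxv : ∀ i, inner ℝ (v i) x = 0 := fun i =>
      (Submodule.mem_orthogonal _ _).1 hx _ (Submodule.subset_span ⟨i, rfl⟩)
    rw [← Submodule.iInf_orthogonal, Submodule.mem_iInf]
    intro μ
    rw [Submodule.mem_orthogonal]
    intro y hy
    have hWy : W y = μ • y := Module.End.mem_eigenspace_iff.1 hy
    rcases lt_trichotomy μ 0 with hμ | rfl | hμ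
    · have h1 : 0 ≤ μ * ‖y‖ ^ 2 := by
        rw [← real_inner_self_eq_norm_sq, ← real_inner_smul_right, ← hWy, ← hSS]
        exact real_inner_self_nonneg
      have h2 : ‖y‖ = 0 := by
        by_contra h
        have : 0 < ‖y‖ ^ 2 := by positivity
        nlinarith
      simp [norm_eq_zero.1 h2]
    · have hyK : y ∈ K := by simpa [K] using hWy
      have h1 := c.hasSum_repr ⟨y, hyK⟩
      have h2 := (h1.mapL K.subtypeL).mapL (innerSL ℝ x)
      have h3 : ∀ k, innerSL ℝ x (K.subtypeL (c.repr ⟨y, hyK⟩ k • c k)) = 0 := fun k => by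
        have h := hxv (Sum.inr k)
        rw [real_inner_comm] at h
        simpa [v, real_inner_smul_right] using Or.inr h
      simp only [h3] at h2
      rw [real_inner_comm]
      exact h2.unique hasSum_zero
    · have h1 := hspan μ hμ hy
      refine (Submodule.mem_orthogonal _ _).1 ?_ y h1
      refine Submodule.orthogonal_le (Submodule.span_mono ?_) hx
      rintro _ ⟨m, rfl⟩
      exact ⟨Sum.inl m, rfl⟩
  refine ⟨κ, HilbertBasis.mkOfOrthogonalEqBot hv htot, fun i x => ?_⟩
  rw [HilbertBasis.coe_mkOfOrthogonalEqBot, hSS]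
  rcases i with m | k
  · simp [v, heW, real_inner_smul_right]
  · simp [v, hcW]

end Spectral

/-! ### Upper and lower bounds for the information complexity in Hilbert spaces. -/

section InformationComplexity

variable {F G : Type*} [NormedAddCommGroup F] [InnerProductSpace ℝ F]
  [NormedAddCommGroup G] [InnerProductSpace ℝ G]

theorem infoComplexity_le {T : F →L[ℝ] G} {ε : ℝ} {n : ℕ} {A : F → G}
    (hA : A ∈ linearAlgorithms F G n) (h : ∀ f, ‖f‖ ≤ 1 → ‖T f - A f‖ ≤ ε) :
    infoComplexity T ε ≤ n := by
  refine iInf₂_le n ⟨A, hA, iSup₂_le fun f hf => ?_⟩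
  rw [← ofReal_norm]
  exact ENNReal.ofReal_le_ofReal (h f (by simpa using hf))

/-- If `‖T f‖ ≤ ε ‖f‖` for all `f` orthogonal to `U`, then `#U` functionals are enough. -/
theorem infoComplexity_le_card {T : F →L[ℝ] G} {ε : ℝ} (hε : 0 ≤ ε) (U : Finset F)
    (h : ∀ f, (∀ u ∈ U, inner ℝ u f = 0) → ‖T f‖ ≤ ε * ‖f‖) :
    infoComplexity T ε ≤ U.card := by
  let K : Submodule ℝ F := Submodule.span ℝ (U : Set F)
  have : FiniteDimensional ℝ K := FiniteDimensional.span_finset ℝ U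
  let c := stdOrthonormalBasis ℝ K
  have hle : Module.finrank ℝ K ≤ U.card := finrank_span_finset_le_card U
  refine le_trans ?_ (Nat.cast_le.2 hle)
  -- The algorithm is `T` after the orthogonal projection onto the span of `U`.
  refine infoComplexity_le (A := fun f => T (K.starProjection f))
    ⟨fun i => innerSL ℝ (c i : F), fun i => T (c i), fun f => ?_⟩ fun f hf => ?_
  · have h1 := c.sum_repr (K.orthogonalProjectionOnto f)
    have h2 := congrArg (fun x : K => T (x : F)) h1
    simp only [Submodule.coe_sum, Submodule.coe_smul, map_sum, map_smul] at h2
    change T (K.orthogonalProjectionOnto f : F) = _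
    rw [← h2]
    refine Finset.sum_congr rfl fun i _ => ?_
    rw [c.repr_apply_apply, Submodule.inner_orthogonalProjectionOnto_eq_of_mem_left,
      innerSL_apply_apply]
  · rw [← map_sub]
    refine (h _ fun u hu => ?_).trans ?_
    · exact (Submodule.mem_orthogonal _ _).1 (K.sub_starProjection_mem_orthogonal f) u
        (Submodule.subset_span hu)
    · refine mul_le_of_le_one_right hε (le_trans ?_ hf)
      have h1 := K.norm_sq_eq_add_norm_sq_starProjection f
      rw [Submodule.starProjection_orthogonal_val] at h1
      exact le_of_sq_le_sq (by nlinarith [sq_nonneg ‖K.starProjection f‖]) (norm_nonneg _)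

/-- Orthogonal vectors with orthogonal images, on which `T` is larger than `ε`, give a lower bound
for the information complexity. -/
theorem card_le_infoComplexity {T : F →L[ℝ] G} {ε : ℝ} (hε : 0 ≤ ε) {α : Type*} [Fintype α]
    (v : α → F) (c : α → ℝ) (hv : ∀ i, v i ≠ 0) (hvo : Pairwise fun i j => inner ℝ (v i) (v j) = 0)
    (hT : ∀ i j, inner ℝ (T (v i)) (T (v j)) = c j * inner ℝ (v i) (v j))
    (hc : ∀ i, ε ^ 2 < c i) : (Fintype.card α : ℕ∞) ≤ infoComplexity T ε := by
  classical
  refine le_iInf₂ ?_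
  rintro n ⟨A, ⟨L, g, hA⟩, hAε⟩
  rw [Nat.cast_le]
  by_contra! hn
  let Φ : (α → ℝ) →ₗ[ℝ] F := Fintype.linearCombination ℝ v
  let Ψ : (α → ℝ) →ₗ[ℝ] (Fin n → ℝ) := LinearMap.pi fun j => (L j : F →ₗ[ℝ] ℝ).comp Φ
  -- With fewer functionals than vectors, some nontrivial combination is annihilated by all of them.
  -- The algorithm returns `0` there, although `T` stretches it by more than `ε`.
  obtain ⟨x, hx, hx0⟩ : ∃ x ∈ LinearMap.ker Ψ, x ≠ 0 :=
    Submodule.exists_mem_ne_zero_of_ne_bot (LinearMap.ker_ne_bot_of_finrank_lt (by simpa using hn))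
  obtain ⟨i₀, hi₀⟩ : ∃ i, x i ≠ 0 := Function.ne_iff.1 hx0
  set f := Φ x
  have hfe : f = ∑ i, x i • v i := Fintype.linearCombination_apply ℝ v x
  have hLf : ∀ j, L j f = 0 := fun j => congrFun (LinearMap.mem_ker.1 hx) j
  have hAf : ∀ r : ℝ, A (r • f) = 0 := fun r => by simp [hA, hLf]
  have hsum : ∀ (j : α), (∑ i, x i * inner ℝ (v i) (v j)) = x j * ‖v j‖ ^ 2 := fun j => by
    rw [Finset.sum_eq_single j, real_inner_self_eq_norm_sq]
    · intro i _ hij; rw [hvo hij, mul_zero]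
    · simp
  have hnf : ‖f‖ ^ 2 = ∑ j, x j ^ 2 * ‖v j‖ ^ 2 := by
    rw [← real_inner_self_eq_norm_sq, hfe, inner_sum]
    refine Finset.sum_congr rfl fun j _ => ?_
    rw [real_inner_smul_right, sum_inner]
    simp only [real_inner_smul_left, hsum]
    ring
  have hnTf : ‖T f‖ ^ 2 = ∑ j, c j * (x j ^ 2 * ‖v j‖ ^ 2) := by
    rw [← real_inner_self_eq_norm_sq, hfe, map_sum, inner_sum]
    refine Finset.sum_congr rfl fun j _ => ?_
    rw [map_smul, real_inner_smul_right, sum_inner]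
    simp only [map_smul, real_inner_smul_left, hT]
    have h1 : ∑ i, x i * (c j * inner ℝ (v i) (v j)) = c j * (x j * ‖v j‖ ^ 2) := by
      rw [← hsum, Finset.mul_sum]
      exact Finset.sum_congr rfl fun i _ => by ring
    rw [h1]
    ring
  have hpos : ∀ j, 0 < ‖v j‖ ^ 2 := fun j => by have := norm_pos_iff.2 (hv j); positivity
  have hi₀' : 0 < x i₀ ^ 2 * ‖v i₀‖ ^ 2 := mul_pos (by positivity) (hpos i₀)
  have hlt : ε ^ 2 * ‖f‖ ^ 2 < ‖T f‖ ^ 2 := by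
    rw [hnf, hnTf, Finset.mul_sum]
    refine Finset.sum_lt_sum (fun j _ => ?_) ⟨i₀, Finset.mem_univ _, ?_⟩
    · have := hpos j
      exact mul_le_mul_of_nonneg_right (hc j).le (by positivity)
    · exact mul_lt_mul_of_pos_right (hc i₀) hi₀'
  have hf0 : 0 < ‖f‖ := by
    rw [norm_pos_iff]
    intro h0
    rw [h0] at hlt
    simp at hlt
  have hle : ‖T (‖f‖⁻¹ • f) - A (‖f‖⁻¹ • f)‖ ≤ ε := by
    have h1 : ‖T (‖f‖⁻¹ • f) - A (‖f‖⁻¹ • f)‖ₑ ≤ ENNReal.ofReal ε := by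
      refine le_trans ?_ hAε
      refine le_iSup₂ (f := fun f (_ : f ∈ Metric.closedBall (0 : F) 1) => ‖T f - A f‖ₑ) _ ?_
      simp [norm_smul, hf0.ne']
    rw [← ofReal_norm] at h1
    exact (ENNReal.ofReal_le_ofReal_iff hε).1 h1
  rw [hAf, sub_zero, map_smul, norm_smul, norm_inv, norm_norm, inv_mul_le_iff₀ hf0] at hle
  have h2 := pow_le_pow_left₀ (norm_nonneg _) hle 2
  rw [mul_pow] at h2
  linarith

end InformationComplexity

/-! ### Orthonormal bases and singular vectors of Hilbert tensor powers. -/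

section TensorPower

variable {H G : Type*} [NormedAddCommGroup H] [InnerProductSpace ℝ H]
  [NormedAddCommGroup G] [InnerProductSpace ℝ G]

namespace HilbertTensorPower

theorem dense_span_tmul (H : Type*) [NormedAddCommGroup H] [InnerProductSpace ℝ H] (d : ℕ) :
    (Submodule.span ℝ (Set.range (tmul : (Fin d → H) → HilbertTensorPower H d))).topologicalClosure
      = ⊤ := by
  rw [eq_top_iff]
  intro x _
  refine UniformSpace.Completion.induction_on x
    (Submodule.isClosed_topologicalClosure _) fun a => ?_
  refine Submodule.le_topologicalClosure _ ?_
  obtain ⟨n, c, f, rfl⟩ := AlgTensorPower.exists_sum a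
  have h : ((∑ i, c i • AlgTensorPower.tmul H d (f i) : AlgTensorPower H d) :
      HilbertTensorPower H d) = ∑ i, c i • tmul (f i) := by
    rw [← UniformSpace.Completion.coe_toComplL (𝕜 := ℝ), map_sum]
    simp only [map_smul]
    rfl
  rw [h]
  exact Submodule.sum_mem _ fun i _ => Submodule.smul_mem _ _ (Submodule.subset_span ⟨_, rfl⟩)

theorem clm_ext {d : ℕ} {X : Type*} [NormedAddCommGroup X] [NormedSpace ℝ X]
    {A B : HilbertTensorPower H d →L[ℝ] X} (h : ∀ f : Fin d → H, A (tmul f) = B (tmul f)) :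
    A = B := by
  refine ContinuousLinearMap.ext_on (s := Set.range tmul) ?_ ?_
  · exact Submodule.dense_iff_topologicalClosure_eq_top.2 (dense_span_tmul H d)
  · rintro _ ⟨f, rfl⟩
    exact h f

theorem norm_tmul {d : ℕ} (f : Fin d → H) : ‖(tmul f : HilbertTensorPower H d)‖ = ∏ k, ‖f k‖ := by
  refine (sq_eq_sq₀ (norm_nonneg _) (Finset.prod_nonneg fun _ _ => norm_nonneg _)).1 ?_
  rw [← real_inner_self_eq_norm_sq, inner_tmul, ← Finset.prod_pow]
  simp only [real_inner_self_eq_norm_sq]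

/-- `tmul` with all arguments but one fixed. -/
def tmulUpdate {d : ℕ} (g : Fin d → H) (k : Fin d) : H →L[ℝ] HilbertTensorPower H d :=
  ((UniformSpace.Completion.toComplL (𝕜 := ℝ) (E := AlgTensorPower H d) :
    AlgTensorPower H d →ₗ[ℝ] HilbertTensorPower H d).comp
      ((AlgTensorPower.tmul H d).toLinearMap g k)).mkContinuous
      (∏ i ∈ Finset.univ.erase k, ‖g i‖) fun v => by
    change ‖(tmul (Function.update g k v) : HilbertTensorPower H d)‖ ≤ _
    rw [norm_tmul, ← Finset.mul_prod_erase _ _ (Finset.mem_univ k), Function.update_self, mul_comm]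
    refine le_of_eq (congrArg (· * ‖v‖) (Finset.prod_congr rfl fun i hi => ?_))
    rw [Function.update_of_ne (Finset.ne_of_mem_erase hi)]

theorem tmulUpdate_apply {d : ℕ} (g : Fin d → H) (k : Fin d) (v : H) :
    tmulUpdate g k v = tmul (Function.update g k v) := rfl

variable {ι : Type*}

theorem orthonormal_tmul {d : ℕ} {b : ι → H} (hb : Orthonormal ℝ b) :
    Orthonormal ℝ fun j : Fin d → ι => (tmul (fun k => b (j k)) : HilbertTensorPower H d) := by
  refine ⟨fun j => ?_, fun i j hij => ?_⟩
  · rw [norm_tmul]; simp [hb.1]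
  · obtain ⟨k, hk⟩ := Function.ne_iff.1 hij
    change inner ℝ (tmul _) (tmul _) = _
    rw [inner_tmul]
    exact Finset.prod_eq_zero (Finset.mem_univ k) (hb.2 hk)

/-- The tensor products of the elements of a total family are total. -/
theorem orthogonal_span_tmul {d : ℕ} {b : ι → H}
    (hb : Dense (Submodule.span ℝ (Set.range b) : Set H)) :
    (Submodule.span ℝ (Set.range fun j : Fin d → ι =>
      (tmul (fun k => b (j k)) : HilbertTensorPower H d)))ᗮ = ⊥ := by
  rw [eq_bot_iff]
  intro x hx
  have hx' : ∀ j : Fin d → ι, inner ℝ x (tmul fun k => b (j k)) = 0 := fun j => by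
    rw [real_inner_comm]
    exact (Submodule.mem_orthogonal _ _).1 hx _ (Submodule.subset_span ⟨j, rfl⟩)
  -- Basis vectors are replaced by arbitrary ones slot by slot: `s` holds the slots already freed,
  -- and density of the span of `b` frees one more.
  have key : ∀ (s : Finset (Fin d)) (g : Fin d → H), (∀ k ∉ s, g k ∈ Set.range b) →
      inner ℝ x (tmul g) = 0 := by
    intro s
    induction s using Finset.induction_on with
    | empty =>
      intro g hg
      choose j hj using fun k => hg k (Finset.notMem_empty k)
      rw [← hx' j]
      simp only [hj]
    | insert a s ha ih =>
      intro g hg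
      have h0 : (innerSL ℝ x).comp (tmulUpdate g a) = 0 := by
        refine ContinuousLinearMap.ext_on hb ?_
        rintro _ ⟨i, rfl⟩
        refine ih _ fun k hk => ?_
        rcases eq_or_ne k a with rfl | hka
        · simp
        · rw [Function.update_of_ne hka]
          exact hg k (by simp [hka, hk])
      have h1 := DFunLike.congr_fun h0 (g a)
      simpa [tmulUpdate_apply] using h1
  have h0 : innerSL ℝ x = 0 := clm_ext fun f => key Finset.univ f (by simp)
  have h1 := DFunLike.congr_fun h0 x
  simpa using h1

theorem inner_map_tmul {S : H →L[ℝ] G} {b : ι → H} {w : ι → ℝ}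
    (hw : ∀ i x, inner ℝ (S x) (S (b i)) = w i * inner ℝ x (b i)) {d : ℕ} (j : Fin d → ι)
    (f : HilbertTensorPower H d) :
    inner ℝ (map S d f) (map S d (tmul fun k => b (j k))) =
      (∏ k, w (j k)) * inner ℝ f (tmul fun k => b (j k)) := by
  have h : (innerSL ℝ (map S d (tmul fun k => b (j k)))).comp (map S d) =
      (∏ k, w (j k)) • innerSL ℝ (tmul fun k => b (j k)) := by
    refine clm_ext fun f => ?_
    simp only [ContinuousLinearMap.comp_apply, innerSL_apply_apply, smul_apply,
      smul_eq_mul]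
    rw [real_inner_comm, real_inner_comm (tmul f), map_tmul, map_tmul, inner_tmul, inner_tmul,
      ← Finset.prod_mul_distrib]
    exact Finset.prod_congr rfl fun k _ => hw _ _
  have h1 := DFunLike.congr_fun h f
  simp only [ContinuousLinearMap.comp_apply, innerSL_apply_apply, smul_apply,
      smul_eq_mul] at h1
  rw [real_inner_comm, h1, real_inner_comm]

/-- `map S d` is bounded by `ε` on the elements that are orthogonal to all singular vectors with
singular values greater than `ε`. -/
theorem norm_map_le_of_orthogonal {S : H →L[ℝ] G} (b : HilbertBasis ι ℝ H) {w : ι → ℝ}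
    (hw : ∀ i x, inner ℝ (S x) (S (b i)) = w i * inner ℝ x (b i)) {d : ℕ} {ε : ℝ} (hε : 0 ≤ ε)
    {f : HilbertTensorPower H d}
    (hf : ∀ j : Fin d → ι, ε ^ 2 < ∏ k, w (j k) → inner ℝ f (tmul fun k => b (j k)) = 0) :
    ‖map S d f‖ ≤ ε * ‖f‖ := by
  have hb : Dense (Submodule.span ℝ (Set.range b) : Set H) :=
    Submodule.dense_iff_topologicalClosure_eq_top.2 b.dense_span
  let t := HilbertBasis.mkOfOrthogonalEqBot (orthonormal_tmul (d := d) b.orthonormal)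
    (orthogonal_span_tmul hb)
  have ht : ∀ j, t j = tmul fun k => b (j k) := fun j => by
    simp only [t, HilbertBasis.coe_mkOfOrthogonalEqBot]
  refine le_of_sq_le_sq ?_ (by positivity)
  rw [mul_pow, ← real_inner_self_eq_norm_sq, ← real_inner_self_eq_norm_sq]
  -- Parseval: both squared norms become series over `j`, compared term by term. Where the weight
  -- exceeds `ε ^ 2`, the coefficient of `f` vanishes.
  have h1 := (t.hasSum_repr f).mapL ((innerSL ℝ (map S d f)).comp (map S d))
  have h2 := (t.hasSum_inner_mul_inner f f).mul_left (ε ^ 2)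
  refine hasSum_le (fun j => ?_) h1 h2
  simp only [map_smul, ContinuousLinearMap.comp_apply, innerSL_apply_apply, smul_eq_mul,
    t.repr_apply_apply, ht, inner_map_tmul hw]
  rw [real_inner_comm f]
  rcases le_or_gt (∏ k, w (j k)) (ε ^ 2) with h | h
  · nlinarith [sq_nonneg (inner ℝ f (tmul fun k => b (j k)) : ℝ)]
  · simp [hf j h]

end HilbertTensorPower

end TensorPower

/-! ### The group of coordinate permutations and its orbits on index vectors. -/

section CoordPerms

variable {d : ℕ} {I : Finset (Fin d)}

theorem mem_coordPerms {π : Equiv.Perm (Fin d)} :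
    π ∈ coordPerms I ↔ ∀ i, i ∉ I → π i = i := by
  simp [coordPerms]

theorem one_mem_coordPerms : (1 : Equiv.Perm (Fin d)) ∈ coordPerms I :=
  mem_coordPerms.2 fun _ _ => rfl

theorem mul_mem_coordPerms {σ π : Equiv.Perm (Fin d)} (hσ : σ ∈ coordPerms I)
    (hπ : π ∈ coordPerms I) : σ * π ∈ coordPerms I :=
  mem_coordPerms.2 fun i hi => by
    rw [Equiv.Perm.mul_apply, mem_coordPerms.1 hπ i hi, mem_coordPerms.1 hσ i hi]

theorem inv_mem_coordPerms {π : Equiv.Perm (Fin d)} (hπ : π ∈ coordPerms I) :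
    π⁻¹ ∈ coordPerms I :=
  mem_coordPerms.2 fun i hi => by
    rw [Equiv.Perm.inv_eq_iff_eq, mem_coordPerms.1 hπ i hi]

theorem card_coordPerms_pos : 0 < ((coordPerms I).card : ℝ) := by
  exact_mod_cast Finset.card_pos.2 ⟨1, one_mem_coordPerms⟩

theorem sum_coordPerms_mul_left {M : Type*} [AddCommMonoid M] {σ : Equiv.Perm (Fin d)}
    (hσ : σ ∈ coordPerms I) (f : Equiv.Perm (Fin d) → M) :
    ∑ π ∈ coordPerms I, f (σ * π) = ∑ π ∈ coordPerms I, f π :=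
  Finset.sum_equiv (Equiv.mulLeft σ) (fun π => ⟨fun h => mul_mem_coordPerms hσ h, fun h => by
    simpa using mul_mem_coordPerms (inv_mem_coordPerms hσ) h⟩) fun _ _ => rfl

theorem sum_coordPerms_inv {M : Type*} [AddCommMonoid M] (f : Equiv.Perm (Fin d) → M) :
    ∑ π ∈ coordPerms I, f π⁻¹ = ∑ π ∈ coordPerms I, f π :=
  Finset.sum_equiv (Equiv.inv _) (fun π => ⟨fun h => inv_mem_coordPerms h, fun h => by
    simpa using inv_mem_coordPerms h⟩) fun _ _ => rfl

/-- Two index vectors that agree outside `I` and take all values equally often on `I` differ by a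
permutation of the coordinates in `I`. -/
theorem exists_mem_coordPerms {ι : Type*} [DecidableEq ι] {j j' : Fin d → ι}
    (hout : ∀ k, k ∉ I → j k = j' k)
    (hcount : ∀ i, (I.filter fun k => j k = i).card = (I.filter fun k => j' k = i).card) :
    ∃ π ∈ coordPerms I, (fun k => j (π k)) = j' := by
  -- Each position outside `I` is labelled by itself, so a bijection matching the fibres of the
  -- labels automatically fixes it.
  let J : (Fin d → ι) → Fin d → ι ⊕ Fin d := fun j k => if k ∈ I then Sum.inl (j k) else Sum.inr k
  have hin : ∀ (j : Fin d → ι) k i, J j k = Sum.inl i ↔ k ∈ I ∧ j k = i := fun j k i => by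
    by_cases h : k ∈ I <;> simp [J, h]
  have hnot : ∀ (j : Fin d → ι) k l, J j k = Sum.inr l ↔ k ∉ I ∧ k = l := fun j k i => by
    by_cases h : k ∈ I <;> simp [J, h]
  have hcard : ∀ c, Nonempty ({k // J j' k = c} ≃ {k // J j k = c}) := by
    rintro (i | l)
    · refine ⟨Fintype.equivOfCardEq ?_⟩
      rw [Fintype.card_subtype, Fintype.card_subtype]
      simp only [hin, ← Finset.filter_filter, Finset.filter_univ_mem]
      exact (hcount i).symm
    · exact ⟨Equiv.subtypeEquivRight fun k => by rw [hnot, hnot]⟩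
  let π : Equiv.Perm (Fin d) := Equiv.ofFiberEquiv fun c => (hcard c).some
  have hπ : ∀ k, J j (π k) = J j' k := fun k => Equiv.ofFiberEquiv_map _ k
  have hfix : ∀ k, k ∉ I → π k = k := fun k hk =>
    ((hnot j _ _).1 ((hπ k).trans ((hnot j' k k).2 ⟨hk, rfl⟩))).2
  refine ⟨π, mem_coordPerms.2 hfix, funext fun k => ?_⟩
  by_cases hk : k ∈ I
  · exact ((hin j _ _).1 ((hπ k).trans ((hin j' k _).2 ⟨hk, rfl⟩))).2
  · simp only [hfix k hk, hout k hk]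

end CoordPerms

/-! ### Counting classes of index vectors. -/

section Counting

variable {d : ℕ} {ι : Type*} [DecidableEq ι]

/-- The multiplicities add up to `I.card`, so one of them is redundant. Dropping that of `i₀` saves
a factor `d + 1` when `i₀` carries the weight `1`. -/
theorem card_filter_eq_of_erase {I : Finset (Fin d)} {B : Finset ι} {i₀ : ι} {j j' : Fin d → ι}
    (hj : ∀ k, j k ∈ B) (hj' : ∀ k, j' k ∈ B)
    (h : ∀ i ∈ B.erase i₀, (I.filter fun k => j k = i).card = (I.filter fun k => j' k = i).card)
    (i : ι) : (I.filter fun k => j k = i).card = (I.filter fun k => j' k = i).card := by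
  by_cases hiB : i ∈ B
  · by_cases hi : i = i₀
    · subst hi
      have h1 := Finset.card_eq_sum_card_fiberwise (s := I) (t := B) (f := j) fun k _ => hj k
      have h2 := Finset.card_eq_sum_card_fiberwise (s := I) (t := B) (f := j') fun k _ => hj' k
      rw [← Finset.add_sum_erase _ _ hiB] at h1 h2
      rw [Finset.sum_congr rfl h] at h1
      omega
    · exact h i (Finset.mem_erase.2 ⟨hi, hiB⟩)
  · rw [Finset.filter_false_of_mem, Finset.filter_false_of_mem]
    · rintro k - rfl; exact hiB (hj' k)
    · rintro k - rfl; exact hiB (hj k)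

/-- The number of classes, modulo permutations of the coordinates in `I`, of index vectors `j` with
`δ < ∏ k, a (j k)`. -/
theorem card_image_mul_le {X : Type*} [DecidableEq X] {I : Finset (Fin d)} {u : (Fin d → ι) → X}
    (hu : ∀ j, ∀ π ∈ coordPerms I, u (fun k => j (π k)) = u j) {a : ι → ℝ} (ha0 : ∀ i, 0 ≤ a i)
    (ha1 : ∀ i, a i ≤ 1) (B : Finset ι) (i₀ : ι) {δ : ℝ} :
    ((((Fintype.piFinset fun _ : Fin d => B).filter fun j => δ < ∏ k, a (j k)).image u).card : ℝ)
      * δ ≤ (∑ i ∈ B, a i) ^ (d - I.card) *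
        ∏ i ∈ B.erase i₀, ∑ t ∈ Finset.range (d + 1), a i ^ t := by
  classical
  set J := (Fintype.piFinset fun _ : Fin d => B).filter fun j => δ < ∏ k, a (j k)
  let C := ({k // k ∉ I} → ι) × ({i // i ∈ B.erase i₀} → ℕ)
  let code : (Fin d → ι) → C := fun j => (fun k => j k, fun i => (I.filter fun k => j k = i).card)
  -- The powers of `a i₀` coming from `I` are left out; since `a i₀ ≤ 1`, this only increases the
  -- weight.
  let wt : C → ℝ := fun c => (∏ k, a (c.1 k)) * ∏ i : {i // i ∈ B.erase i₀}, a i ^ c.2 i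
  have hwt0 : ∀ c, 0 ≤ wt c := fun c => mul_nonneg (Finset.prod_nonneg fun _ _ => ha0 _)
    (Finset.prod_nonneg fun _ _ => pow_nonneg (ha0 _) _)
  have hmem : ∀ j ∈ J, ∀ k, j k ∈ B := fun j hj k =>
    Fintype.mem_piFinset.1 (Finset.mem_filter.1 hj).1 k
  have hcode : ∀ j ∈ J, ∀ j' ∈ J, code j = code j' → u j = u j' := fun j hj j' hj' h => by
    obtain ⟨π, hπ, rfl⟩ := exists_mem_coordPerms (I := I) (j := j) (j' := j')
      (fun k hk => congrFun (congrArg Prod.fst h) ⟨k, hk⟩)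
      (card_filter_eq_of_erase (hmem j hj) (hmem j' hj')
        fun i hi => congrFun (congrArg Prod.snd h) ⟨i, hi⟩)
    exact (hu j π hπ).symm
  have : Nonempty (Fin d → ι) := ⟨fun _ => i₀⟩
  have hcard : (J.image u).card ≤ (J.image code).card := by
    have hsub : J.image u ⊆ (J.image code).image fun c => u (Function.invFunOn code J c) := by
      intro x hx
      obtain ⟨j, hj, rfl⟩ := Finset.mem_image.1 hx
      have hex : ∃ j' ∈ (J : Set (Fin d → ι)), code j' = code j := ⟨j, hj, rfl⟩
      exact Finset.mem_image.2 ⟨code j, Finset.mem_image_of_mem _ hj,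
        hcode _ (Function.invFunOn_mem hex) _ hj (Function.invFunOn_eq hex)⟩
    exact (Finset.card_le_card hsub).trans Finset.card_image_le
  have hle : ∀ j ∈ J, δ ≤ wt (code j) := fun j hj => by
    refine (Finset.mem_filter.1 hj).2.le.trans ?_
    have h1 : ∏ k ∈ I, a (j k) ≤ ∏ i : {i // i ∈ B.erase i₀}, a i ^ (code j).2 i := by
      rw [← Finset.prod_fiberwise_of_maps_to (s := I) (t := B) (g := j) fun k _ => hmem j hj k]
      have h2 : ∀ i, ∏ k ∈ I with j k = i, a (j k) = a i ^ (I.filter fun k => j k = i).card :=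
        fun i => Finset.prod_eq_pow_card fun k hk => by rw [(Finset.mem_filter.1 hk).2]
      simp only [h2]
      rw [Finset.prod_coe_sort (B.erase i₀) fun i => a i ^ (I.filter fun k => j k = i).card]
      by_cases hi : i₀ ∈ B
      · rw [← Finset.mul_prod_erase _ _ hi]
        exact mul_le_of_le_one_left (Finset.prod_nonneg fun _ _ => pow_nonneg (ha0 _) _)
          (pow_le_one₀ (ha0 _) (ha1 _))
      · rw [Finset.erase_eq_of_notMem hi]
    rw [← Finset.prod_mul_prod_compl I, mul_comm]
    refine mul_le_mul (le_of_eq ?_) h1 (Finset.prod_nonneg fun _ _ => ha0 _)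
      (Finset.prod_nonneg fun _ _ => ha0 _)
    exact Finset.prod_subtype _ (fun k => Finset.mem_compl) fun k => a (j k)
  let D : Finset C := (Fintype.piFinset fun _ => B) ×ˢ
    (Fintype.piFinset fun _ => Finset.range (d + 1))
  have hD : J.image code ⊆ D := by
    intro c hc
    obtain ⟨j, hj, rfl⟩ := Finset.mem_image.1 hc
    refine Finset.mem_product.2 ⟨Fintype.mem_piFinset.2 fun k => hmem j hj k,
      Fintype.mem_piFinset.2 fun i => Finset.mem_range.2 (Nat.lt_succ_of_le ?_)⟩
    exact (Finset.card_le_univ _).trans_eq (Fintype.card_fin d)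
  have hprod0 : 0 ≤ (∑ i ∈ B, a i) ^ (d - I.card) *
        ∏ i ∈ B.erase i₀, ∑ t ∈ Finset.range (d + 1), a i ^ t :=
    mul_nonneg (pow_nonneg (Finset.sum_nonneg fun _ _ => ha0 _) _)
      (Finset.prod_nonneg fun _ _ => Finset.sum_nonneg fun _ _ => pow_nonneg (ha0 _) _)
  rcases le_or_gt δ 0 with hδ | hδ
  · exact (mul_nonpos_of_nonneg_of_nonpos (Nat.cast_nonneg _) hδ).trans hprod0
  -- Markov's inequality: every occurring code weighs at least `δ`, and the total weight of the box
  -- `D` factorizes.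
  calc ((J.image u).card : ℝ) * δ ≤ (J.image code).card * δ := by gcongr
    _ = ∑ c ∈ J.image code, δ := by rw [Finset.sum_const, nsmul_eq_mul]
    _ ≤ ∑ c ∈ J.image code, wt c := Finset.sum_le_sum fun c hc => by
        obtain ⟨j, hj, rfl⟩ := Finset.mem_image.1 hc
        exact hle j hj
    _ ≤ ∑ c ∈ D, wt c := Finset.sum_le_sum_of_subset_of_nonneg hD fun c _ _ => hwt0 c
    _ = (∏ k : {k // k ∉ I}, ∑ i ∈ B, a i) *
        ∏ i : {i // i ∈ B.erase i₀}, ∑ t ∈ Finset.range (d + 1), a i ^ t := by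
        rw [Finset.prod_univ_sum, Finset.prod_univ_sum, Finset.sum_mul_sum, Finset.sum_product]
    _ = _ := by
        rw [Finset.prod_const, Finset.card_univ, Fintype.card_subtype_compl, Fintype.card_fin,
          Fintype.card_coe,
          Finset.prod_coe_sort (B.erase i₀) fun i => ∑ t ∈ Finset.range (d + 1), a i ^ t]

/-- Outside `E` a geometric sum is at most 1/(1-a) = 1 + a/(1-a) ≤ exp(a/(1-θ)), so the product of
these factors is bounded independently of `d`; inside `E` the trivial bound `d + 1` is used. -/
theorem prod_sum_pow_le {a : ι → ℝ} (ha0 : ∀ i, 0 ≤ a i) (ha1 : ∀ i, a i ≤ 1) (B E : Finset ι)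
    {θ : ℝ} (hθ : θ < 1) (hE : ∀ i ∈ B, i ∉ E → a i ≤ θ) (d : ℕ) :
    ∏ i ∈ B, ∑ t ∈ Finset.range (d + 1), a i ^ t ≤
      (d + 1 : ℝ) ^ E.card * Real.exp ((∑ i ∈ B, a i) / (1 - θ)) := by
  have hθ' : 0 < 1 - θ := sub_pos.2 hθ
  have h1 : ∀ i ∈ B, ∑ t ∈ Finset.range (d + 1), a i ^ t ≤
      (if i ∈ E then (d + 1 : ℝ) else 1) * Real.exp (a i / (1 - θ)) := fun i hi => by
    have hexp : 1 ≤ Real.exp (a i / (1 - θ)) := Real.one_le_exp (div_nonneg (ha0 i) hθ'.le)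
    split_ifs with h
    · have h2 : ∑ t ∈ Finset.range (d + 1), a i ^ t ≤ (d + 1 : ℝ) := by
        refine (Finset.sum_le_card_nsmul _ _ 1 fun t _ => pow_le_one₀ (ha0 i) (ha1 i)).trans ?_
        simp
      exact h2.trans (le_mul_of_one_le_right (by positivity) hexp)
    · have h3 := hE i hi h
      have h4 : 0 < 1 - a i := by linarith
      rw [one_mul, geom_sum_eq (by linarith)]
      calc (a i ^ (d + 1) - 1) / (a i - 1) = (1 - a i ^ (d + 1)) / (1 - a i) := by
            rw [← neg_div_neg_eq]; ring
        _ ≤ 1 / (1 - a i) := by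
            gcongr
            linarith [pow_nonneg (ha0 i) (d + 1)]
        _ = a i / (1 - a i) + 1 := by field_simp; ring
        _ ≤ a i / (1 - θ) + 1 := by
            have := div_le_div_of_nonneg_left (ha0 i) hθ' (by linarith : 1 - θ ≤ 1 - a i)
            linarith
        _ ≤ _ := Real.add_one_le_exp _
  refine (Finset.prod_le_prod (fun i _ => Finset.sum_nonneg fun _ _ => pow_nonneg (ha0 i) _)
    h1).trans ?_
  rw [Finset.prod_mul_distrib, ← Real.exp_sum, ← Finset.sum_div]
  gcongr
  rw [Finset.prod_ite, Finset.prod_const, Finset.prod_const_one, mul_one]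
  refine pow_le_pow_right₀ (by linarith [Nat.cast_nonneg (α := ℝ) d]) (Finset.card_le_card ?_)
  exact fun i hi => (Finset.mem_filter.1 hi).2

end Counting

/-! ### Symmetrized singular vectors and the complexity of the symmetric problem. -/

section Symmetric

variable {H G : Type*} [NormedAddCommGroup H] [InnerProductSpace ℝ H]
  [NormedAddCommGroup G] [InnerProductSpace ℝ G] {d : ℕ} {I : Finset (Fin d)}

open HilbertTensorPower

theorem symmetrizer_apply (f : HilbertTensorPower H d) :
    symmetrizer H I f = ((coordPerms I).card : ℝ)⁻¹ • ∑ π ∈ coordPerms I, perm π f := by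
  simp [symmetrizer]

theorem perm_perm (π σ : Equiv.Perm (Fin d)) (f : HilbertTensorPower H d) :
    perm π (perm σ f) = perm (σ * π) f := by
  have h : (perm π).comp (perm σ) = (perm (σ * π) : HilbertTensorPower H d →L[ℝ] _) :=
    clm_ext fun f => by
      rw [ContinuousLinearMap.comp_apply, perm_tmul, perm_tmul, perm_tmul]
      rfl
  exact DFunLike.congr_fun h f

theorem symmetrizer_perm {σ : Equiv.Perm (Fin d)} (hσ : σ ∈ coordPerms I)
    (f : HilbertTensorPower H d) : symmetrizer H I (perm σ f) = symmetrizer H I f := by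
  simp only [symmetrizer_apply, perm_perm]
  rw [sum_coordPerms_mul_left hσ fun π => perm π f]

theorem symmetrizer_symmetrizer (f : HilbertTensorPower H d) :
    symmetrizer H I (symmetrizer H I f) = symmetrizer H I f := by
  conv_lhs => rw [symmetrizer_apply f, map_smul, map_sum]
  rw [Finset.sum_congr rfl fun π hπ => symmetrizer_perm hπ f, Finset.sum_const,
    ← Nat.cast_smul_eq_nsmul ℝ, inv_smul_smul₀ card_coordPerms_pos.ne']

theorem symmetrizer_eq_self {f : HilbertTensorPower H d} (hf : f ∈ symmetricSubspace H I) :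
    symmetrizer H I f = f := by
  obtain ⟨g, rfl⟩ := hf
  exact symmetrizer_symmetrizer g

theorem inner_perm_tmul (π : Equiv.Perm (Fin d)) (f : HilbertTensorPower H d) (g : Fin d → H) :
    inner ℝ (perm π f) (tmul g) = inner ℝ f (perm π⁻¹ (tmul g)) := by
  have h : (innerSL ℝ (tmul g)).comp (perm π) = innerSL ℝ (perm π⁻¹ (tmul g)) :=
    clm_ext fun f => by
      rw [ContinuousLinearMap.comp_apply, perm_tmul, perm_tmul, innerSL_apply_apply,
        innerSL_apply_apply, inner_tmul, inner_tmul,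
        ← Equiv.prod_comp π fun k => (inner ℝ (g (π⁻¹ k)) (f k) : ℝ)]
      simp
  have h1 := DFunLike.congr_fun h f
  simp only [ContinuousLinearMap.comp_apply, innerSL_apply_apply] at h1
  rw [real_inner_comm, h1, real_inner_comm]

/-- The adjoint of a permutation is its inverse, and inversion maps `coordPerms I` onto itself. -/
theorem inner_symmetrizer_tmul (f : HilbertTensorPower H d) (g : Fin d → H) :
    inner ℝ (symmetrizer H I f) (tmul g) = inner ℝ f (symmetrizer H I (tmul g)) := by
  rw [symmetrizer_apply, symmetrizer_apply, real_inner_smul_left, real_inner_smul_right, sum_inner,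
    inner_sum]
  simp only [inner_perm_tmul]
  rw [sum_coordPerms_inv fun π => (inner ℝ f (perm π (tmul g)) : ℝ)]

/-- The symmetrized tensor product, as an element of the symmetric subspace. -/
def symTmul (I : Finset (Fin d)) (f : Fin d → H) : symmetricSubspace H I :=
  ⟨symmetrizer H I (tmul f), tmul f, rfl⟩

theorem symTmul_perm {π : Equiv.Perm (Fin d)} (hπ : π ∈ coordPerms I) (f : Fin d → H) :
    symTmul I (fun k => f (π k)) = symTmul I f :=
  Subtype.ext <| by
    change symmetrizer H I (tmul fun k => f (π k)) = symmetrizer H I (tmul f)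
    rw [← perm_tmul, symmetrizer_perm hπ]

/-- The symmetrizer is self-adjoint and fixes `f`. Thus orthogonality to one symmetrized tensor
gives orthogonality to all its permuted simple tensors, and one functional per class suffices. -/
theorem inner_symTmul (f : symmetricSubspace H I) (g : Fin d → H) :
    inner ℝ f (symTmul I g) = inner ℝ (f : HilbertTensorPower H d) (tmul g) := by
  rw [Submodule.coe_inner]
  change inner ℝ (f : HilbertTensorPower H d) (symmetrizer H I (tmul g)) = _
  rw [← inner_symmetrizer_tmul, symmetrizer_eq_self f.2]

/-- For tensors of orthonormal vectors the sum counts the permutations carrying one index vector to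
the other: it vanishes for inequivalent vectors and is positive for equal ones. -/
theorem inner_symTmul_symTmul (f g : Fin d → H) :
    inner ℝ (symTmul I f) (symTmul I g) = ((coordPerms I).card : ℝ)⁻¹ *
      ∑ π ∈ coordPerms I, ∏ k, (inner ℝ (f (π k)) (g k) : ℝ) := by
  rw [inner_symTmul]
  change inner ℝ (symmetrizer H I (tmul f)) (tmul g) = _
  rw [symmetrizer_apply, real_inner_smul_left, sum_inner]
  simp only [perm_tmul, inner_tmul]

variable {ι : Type*}

/-- The product of the weights is invariant under permutations of `j`, so averaging preserves the
singular vector relation. -/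
theorem inner_map_symTmul {S : H →L[ℝ] G} {b : ι → H} {w : ι → ℝ}
    (hw : ∀ i x, inner ℝ (S x) (S (b i)) = w i * inner ℝ x (b i)) (j : Fin d → ι)
    (f : symmetricSubspace H I) :
    inner ℝ (symmetricProblem S I f) (symmetricProblem S I (symTmul I fun k => b (j k))) =
      (∏ k, w (j k)) * inner ℝ f (symTmul I fun k => b (j k)) := by
  rw [Submodule.coe_inner]
  change inner ℝ (map S d f) (map S d (symmetrizer H I (tmul fun k => b (j k)))) =
    _ * inner ℝ (f : HilbertTensorPower H d) (symmetrizer H I (tmul fun k => b (j k)))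
  rw [symmetrizer_apply, (map S d).map_smul, map_sum, real_inner_smul_right, real_inner_smul_right,
    inner_sum, inner_sum, mul_left_comm]
  refine congrArg _ ?_
  rw [Finset.mul_sum]
  refine Finset.sum_congr rfl fun π _ => ?_
  rw [perm_tmul, inner_map_tmul hw fun k => j (π k), Equiv.prod_comp π fun k => w (j k)]

/-- A lower bound for the information complexity: the number of inequivalent index vectors in `Φ`
for which the eigenvalue is greater than `ε ^ 2`. -/
theorem card_le_infoComplexity_symmetricProblem {S : H →L[ℝ] G} {b : ι → H}
    (hb : Orthonormal ℝ b) {w : ι → ℝ}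
    (hw : ∀ i x, inner ℝ (S x) (S (b i)) = w i * inner ℝ x (b i)) {ε : ℝ} (hε : 0 ≤ ε)
    (Φ : Finset (Fin d → ι)) (hΦ : ∀ j ∈ Φ, ε ^ 2 < ∏ k, w (j k))
    (hinj : ∀ j ∈ Φ, ∀ π ∈ coordPerms I, (fun k => j (π k)) ∈ Φ → (fun k => j (π k)) = j) :
    (Φ.card : ℕ∞) ≤ infoComplexity (symmetricProblem S I) ε := by
  classical
  rw [← Fintype.card_coe]
  have hδ : ∀ i i', (inner ℝ (b i) (b i') : ℝ) = if i = i' then 1 else 0 :=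
    orthonormal_iff_ite.1 hb
  refine card_le_infoComplexity hε (fun j : Φ => symTmul I fun k => b (j.1 k))
    (fun j => ∏ k, w (j.1 k)) (fun j h0 => ?_) (fun i j hij => ?_)
    (fun i j => inner_map_symTmul hw _ _) fun j => hΦ j j.2
  · have h : 0 < (inner ℝ (symTmul I fun k => b (j.1 k)) (symTmul I fun k => b (j.1 k)) : ℝ) := by
      rw [inner_symTmul_symTmul]
      refine mul_pos (inv_pos.2 card_coordPerms_pos)
        (Finset.sum_pos' (fun π _ => Finset.prod_nonneg fun k _ => ?_)
          ⟨1, one_mem_coordPerms, ?_⟩)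
      · rw [hδ]; positivity
      · simp [hb.1]
    rw [h0, inner_zero_left] at h
    exact h.false
  · change inner ℝ (symTmul I fun k => b (i.1 k)) (symTmul I fun k => b (j.1 k)) = 0
    rw [inner_symTmul_symTmul]
    refine mul_eq_zero_of_right _ (Finset.sum_eq_zero fun π hπ => ?_)
    by_contra hne
    have heq : (fun k => i.1 (π k)) = j.1 := funext fun k => by
      have h := Finset.prod_ne_zero_iff.1 hne k (Finset.mem_univ k)
      rw [hδ] at h
      by_contra hk
      exact h (if_neg hk)
    have h := hinj i i.2 π hπ (heq ▸ j.2)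
    exact hij (Subtype.ext (h.symm.trans heq))

/-- An upper bound for the information complexity if the singular values are bounded by `1` and
`τ`-summable, and the powers `w i ^ τ` for `i ∉ E`, `i ≠ i₀` are bounded by `θ < 1`. -/
theorem infoComplexity_symmetricProblem_le {S : H →L[ℝ] G} (b : HilbertBasis ι ℝ H) {w : ι → ℝ}
    (hw : ∀ i x, inner ℝ (S x) (S (b i)) = w i * inner ℝ x (b i)) (hw0 : ∀ i, 0 ≤ w i)
    (hw1 : ∀ i, w i ≤ 1) {τ : ℝ} (hτ : 0 < τ) (hsum : Summable fun i => w i ^ τ) (i₀ : ι)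
    (E : Finset ι) {θ : ℝ} (hθ : θ < 1) (hE : ∀ i, i ≠ i₀ → i ∉ E → w i ^ τ ≤ θ) {ε : ℝ}
    (hε : 0 < ε) :
    ∃ n : ℕ, infoComplexity (symmetricProblem S I) ε = n ∧
      (n : ℝ) ≤ ε ^ (-(2 * τ)) * (∑' i, w i ^ τ) ^ (d - I.card) *
        ((d + 1 : ℝ) ^ E.card * Real.exp ((∑' i, w i ^ τ) / (1 - θ))) := by
  classical
  set a : ι → ℝ := fun i => w i ^ τ with ha
  set A := ∑' i, a i
  have ha0 : ∀ i, 0 ≤ a i := fun i => Real.rpow_nonneg (hw0 i) _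
  have ha1 : ∀ i, a i ≤ 1 := fun i => Real.rpow_le_one (hw0 i) (hw1 i) hτ.le
  set δ : ℝ := ε ^ (2 * τ) with hδ
  have hδ0 : 0 < δ := Real.rpow_pos_of_pos hε _
  have hfin : {i | δ < a i}.Finite := by
    have h := hsum.tendsto_cofinite_zero.eventually (gt_mem_nhds hδ0)
    refine (eventually_cofinite.1 h).subset fun i hi => ?_
    exact not_lt.2 (le_of_lt hi)
  -- All factors are at most `1`, so a product above `δ` uses only indices with `a i > δ`. By
  -- summability these are finitely many.
  let B : Finset ι := hfin.toFinset
  let u : (Fin d → ι) → symmetricSubspace H I := fun j => symTmul I fun k => b (j k)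
  let J := (Fintype.piFinset fun _ : Fin d => B).filter fun j => δ < ∏ k, a (j k)
  have hJ : ∀ j : Fin d → ι, ε ^ 2 < ∏ k, w (j k) → j ∈ J := fun j hj => by
    have h1 : δ < ∏ k, a (j k) := by
      rw [ha, Real.finsetProd_rpow _ _ fun k _ => hw0 (j k), hδ, Real.rpow_mul hε.le,
        Real.rpow_two]
      exact Real.rpow_lt_rpow (by positivity) hj hτ
    refine Finset.mem_filter.2 ⟨Fintype.mem_piFinset.2 fun k => hfin.mem_toFinset.2 ?_, h1⟩
    refine lt_of_lt_of_le h1 ?_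
    rw [← Finset.mul_prod_erase _ _ (Finset.mem_univ k)]
    exact mul_le_of_le_one_right (ha0 _) (Finset.prod_le_one (fun _ _ => ha0 _) fun _ _ => ha1 _)
  have hle : infoComplexity (symmetricProblem S I) ε ≤ (J.image u).card := by
    refine infoComplexity_le_card hε.le _ fun f hf => ?_
    refine norm_map_le_of_orthogonal b hw hε.le fun j hj => ?_
    change inner ℝ (f : HilbertTensorPower H d) (tmul fun k => b (j k)) = 0
    rw [← inner_symTmul, real_inner_comm]
    exact hf _ (Finset.mem_image_of_mem u (hJ j hj))
  obtain ⟨n, hn, hnle⟩ := ENat.le_natCast_iff.1 hle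
  refine ⟨n, hn, ?_⟩
  have h1 := card_image_mul_le (I := I) (u := u) (fun j π hπ => symTmul_perm hπ fun k => b (j k))
    ha0 ha1 B i₀ (δ := δ)
  have hBA : ∀ B : Finset ι, ∑ i ∈ B, a i ≤ A := fun B => hsum.sum_le_tsum _ fun i _ => ha0 i
  have hsB : 0 ≤ ∑ i ∈ B, a i := Finset.sum_nonneg fun i _ => ha0 i
  have h2 := prod_sum_pow_le ha0 ha1 (B.erase i₀) E hθ
    (fun i hi hiE => hE i (Finset.ne_of_mem_erase hi) hiE) d
  have hθ' : 0 < 1 - θ := sub_pos.2 hθ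
  have h3 : (J.image u).card * δ ≤
      A ^ (d - I.card) * ((d + 1 : ℝ) ^ E.card * Real.exp (A / (1 - θ))) := by
    refine h1.trans (mul_le_mul (pow_le_pow_left₀ hsB (hBA B) _) (h2.trans ?_) ?_ ?_)
    · gcongr
      exact hBA _
    · exact Finset.prod_nonneg fun _ _ => Finset.sum_nonneg fun _ _ => pow_nonneg (ha0 _) _
    · exact pow_nonneg (hsB.trans (hBA B)) _
  rw [Real.rpow_neg hε.le, mul_assoc, ← hδ, ← div_eq_inv_mul, le_div_iff₀ hδ0]
  refine le_trans ?_ h3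
  gcongr

end Symmetric

/-! ### Complexity bounds in terms of the eigenvalue sequence. -/

section Bounds

variable {H G : Type*} [NormedAddCommGroup H] [InnerProductSpace ℝ H] [CompleteSpace H]
  [NormedAddCommGroup G] [InnerProductSpace ℝ G] [CompleteSpace G]
  {S : H →L[ℝ] G} {lam : ℕ → ℝ}

namespace IsEigenvalueSequence

theorem infoComplexity_le (hlam : IsEigenvalueSequence ((ContinuousLinearMap.adjoint S).comp S) lam)
    (hS : IsCompactOperator S) (h0 : 0 < lam 0) (h1 : lam 0 ≤ 1) {τ : ℝ} (hτ : 0 < τ)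
    (hsum : Summable fun m => lam m ^ τ) {N : ℕ} (hN : lam N < 1) {d : ℕ} (I : Finset (Fin d))
    {ε : ℝ} (hε : 0 < ε) :
    ∃ n : ℕ, infoComplexity (symmetricProblem S I) ε = n ∧
      (n : ℝ) ≤ ε ^ (-(2 * τ)) * (∑' m, lam m ^ τ) ^ (d - I.card) *
        ((d + 1 : ℝ) ^ (N - 1) * Real.exp ((∑' m, lam m ^ τ) / (1 - lam N ^ τ))) := by
  obtain ⟨κ, b, hw⟩ := hlam.exists_hilbertBasis hS
  let w : {m // 0 < lam m} ⊕ κ → ℝ := Sum.elim (fun m => lam m.1) fun _ => 0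
  have hw0 : ∀ i, 0 ≤ w i := by
    rintro (m | k)
    exacts [m.2.le, le_rfl]
  have hw1 : ∀ i, w i ≤ 1 := by
    rintro (m | k)
    exacts [(hlam.antitone (Nat.zero_le _)).trans h1, zero_le_one]
  have hθ : lam N ^ τ < 1 := Real.rpow_lt_one (hlam.nonneg N) hN hτ
  have hhas : HasSum (fun i => w i ^ τ) (∑' m, lam m ^ τ) := by
    rw [← Sum.inl_injective.hasSum_iff]
    · refine (hasSum_subtype_iff_of_support_subset (s := {m | 0 < lam m})
        (f := fun m => lam m ^ τ) fun m hm => ?_).2 hsum.hasSum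
      refine (hlam.nonneg m).lt_of_ne fun h => hm ?_
      simp only [← h, Real.zero_rpow hτ.ne']
    · rintro (m | k) hx
      · exact absurd ⟨m, rfl⟩ hx
      · exact Real.zero_rpow hτ.ne'
  -- The index `0` plays the role of `i₀`, so only `1, …, N - 1` can still have eigenvalue `1`. For
  -- `N = 0` this set is empty, in line with the truncated `N - 1`.
  let E : Finset ({m // 0 < lam m} ⊕ κ) :=
    ((Finset.Ico 1 N).subtype fun m => 0 < lam m).map Function.Embedding.inl
  have hEcard : E.card ≤ N - 1 := by
    rw [Finset.card_map, Finset.card_subtype]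
    exact (Finset.card_filter_le _ _).trans (Nat.card_Ico 1 N).le
  obtain ⟨n, hn, hle⟩ := infoComplexity_symmetricProblem_le (I := I) b hw hw0 hw1 hτ
    hhas.summable (Sum.inl ⟨0, h0⟩) E hθ (by
      rintro (m | k) hi hiE
      · refine Real.rpow_le_rpow m.2.le (hlam.antitone ?_) hτ.le
        by_contra! hlt
        refine hiE (Finset.mem_map.2 ⟨m, Finset.mem_subtype.2 (Finset.mem_Ico.2 ⟨?_, hlt⟩), rfl⟩)
        refine Nat.one_le_iff_ne_zero.2 fun hm => hi ?_
        exact congrArg Sum.inl (Subtype.ext hm)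
      · exact (Real.zero_rpow hτ.ne').trans_le (Real.rpow_nonneg (hlam.nonneg N) _)) hε
  rw [hhas.tsum_eq] at hle
  refine ⟨n, hn, hle.trans ?_⟩
  have hA : 0 ≤ ∑' m, lam m ^ τ := tsum_nonneg fun m => Real.rpow_nonneg (hlam.nonneg m) _
  gcongr
  linarith [Nat.cast_nonneg (α := ℝ) d]

theorem le_infoComplexity (hlam : IsEigenvalueSequence ((ContinuousLinearMap.adjoint S).comp S) lam)
    (hS : IsCompactOperator S) {d : ℕ} {I : Finset (Fin d)} {ε : ℝ} (hε : 0 ≤ ε)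
    (Φ : Finset (Fin d → {m // 0 < lam m})) (hΦ : ∀ j ∈ Φ, ε ^ 2 < ∏ k, lam (j k))
    (hinj : ∀ j ∈ Φ, ∀ π ∈ coordPerms I, (fun k => j (π k)) ∈ Φ → (fun k => j (π k)) = j) :
    (Φ.card : ℕ∞) ≤ infoComplexity (symmetricProblem S I) ε := by
  obtain ⟨κ, b, hw⟩ := hlam.exists_hilbertBasis hS
  exact card_le_infoComplexity_symmetricProblem (b := fun m => b (Sum.inl m))
    (w := fun m => lam m.1) (b.orthonormal.comp _ Sum.inl_injective) (fun m x => hw (Sum.inl m) x)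
    hε Φ hΦ hinj

theorem succ_le_infoComplexity_one
    (hlam : IsEigenvalueSequence ((ContinuousLinearMap.adjoint S).comp S) lam)
    (hS : IsCompactOperator S) {I : Finset (Fin 1)} {ε : ℝ} (hε : 0 ≤ ε) {k : ℕ}
    (hk : ε ^ 2 < lam k) : ((k + 1 : ℕ) : ℕ∞) ≤ infoComplexity (symmetricProblem S I) ε := by
  classical
  have hle : ∀ m : Fin (k + 1), lam k ≤ lam m := fun m => hlam.antitone (Nat.lt_succ_iff.1 m.2)
  have hpos : ∀ m : Fin (k + 1), 0 < lam m := fun m =>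
    (lt_of_le_of_lt (by positivity) hk).trans_le (hle m)
  let e : Fin (k + 1) → Fin 1 → {m // 0 < lam m} := fun m _ => ⟨m, hpos m⟩
  have he : Function.Injective e := fun m n h =>
    Fin.ext (congrArg Subtype.val (congrFun h 0))
  have hcard : (Finset.univ.image e).card = k + 1 := by
    rw [Finset.card_image_of_injective _ he, Finset.card_univ, Fintype.card_fin]
  rw [← hcard]
  refine hlam.le_infoComplexity hS hε _ (fun j hj => ?_) fun j _ π _ _ => ?_
  · obtain ⟨m, -, rfl⟩ := Finset.mem_image.1 hj
    simpa [e] using hk.trans_le (hle m)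
  · rw [Subsingleton.elim π 1]
    rfl

/-- The lower bound for the information complexity that results from index vectors with entries in
`{0, 1}`. -/
theorem card_le_infoComplexity_of_sets
    (hlam : IsEigenvalueSequence ((ContinuousLinearMap.adjoint S).comp S) lam)
    (hS : IsCompactOperator S) (h1 : 0 < lam 1) {d : ℕ} {I : Finset (Fin d)} {ε : ℝ} (hε : 0 ≤ ε)
    (𝒯 : Finset (Finset (Fin d)))
    (h𝒯 : ∀ T ∈ 𝒯, ε ^ 2 < lam 1 ^ T.card * lam 0 ^ (d - T.card))
    (hinj : ∀ T ∈ 𝒯, ∀ π ∈ coordPerms I, (Finset.univ.filter fun k => π k ∈ T) ∈ 𝒯 →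
      (Finset.univ.filter fun k => π k ∈ T) = T) :
    (𝒯.card : ℕ∞) ≤ infoComplexity (symmetricProblem S I) ε := by
  classical
  have h0 : 0 < lam 0 := h1.trans_le (hlam.antitone zero_le_one)
  let e : Finset (Fin d) → Fin d → {m // 0 < lam m} := fun T k =>
    if k ∈ T then ⟨1, h1⟩ else ⟨0, h0⟩
  have hmem : ∀ T k, k ∈ T ↔ e T k = ⟨1, h1⟩ := fun T k => by
    by_cases h : k ∈ T <;> simp [e, h]
  have he : Function.Injective e := fun T T' h => by
    ext k
    rw [hmem, hmem, h]
  rw [← Finset.card_image_of_injective 𝒯 he]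
  refine hlam.le_infoComplexity hS hε _ (fun j hj => ?_) fun j hj π hπ hjπ => ?_
  · obtain ⟨T, hT, rfl⟩ := Finset.mem_image.1 hj
    refine (h𝒯 T hT).trans_eq ?_
    have hval : ∀ k, lam (e T k) = if k ∈ T then lam 1 else lam 0 := fun k => by
      by_cases h : k ∈ T <;> simp [e, h]
    simp only [hval, Finset.prod_ite, Finset.prod_const, Finset.filter_univ_mem]
    rw [← Finset.compl_filter, Finset.filter_univ_mem, Finset.card_compl, Fintype.card_fin]
  · obtain ⟨T, hT, rfl⟩ := Finset.mem_image.1 hj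
    have heq : (fun k => e T (π k)) = e (Finset.univ.filter fun k => π k ∈ T) := by
      funext k
      by_cases h : π k ∈ T <;> simp [e, h]
    rw [heq] at hjπ ⊢
    obtain ⟨T', hT', h⟩ := Finset.mem_image.1 hjπ
    rw [hinj T hT π hπ (he h ▸ hT')]

/-- Initial segments of different lengths are inequivalent because permutations preserve
cardinality; this survives even full symmetry. -/
theorem succ_le_infoComplexity
    (hlam : IsEigenvalueSequence ((ContinuousLinearMap.adjoint S).comp S) lam)
    (hS : IsCompactOperator S) (h1 : 0 < lam 1) {d : ℕ} {I : Finset (Fin d)} {ε : ℝ} (hε : 0 ≤ ε)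
    {K : ℕ} (hK : K ≤ d) (h : ∀ k ≤ K, ε ^ 2 < lam 1 ^ k * lam 0 ^ (d - k)) :
    ((K + 1 : ℕ) : ℕ∞) ≤ infoComplexity (symmetricProblem S I) ε := by
  classical
  let e : ℕ → Finset (Fin d) := fun k => Finset.univ.filter fun i => i.1 < k
  have hcard : ∀ k ≤ K, (e k).card = k := fun k hk => by
    rw [Fin.card_filter_val_lt, min_eq_right (hk.trans hK)]
  have hmem : ∀ T ∈ (Finset.range (K + 1)).image e, ∃ k ≤ K, e k = T := fun T hT => by
    obtain ⟨k, hk, rfl⟩ := Finset.mem_image.1 hT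
    exact ⟨k, Nat.lt_succ_iff.1 (Finset.mem_range.1 hk), rfl⟩
  have hc : ((Finset.range (K + 1)).image e).card = K + 1 := by
    rw [Finset.card_image_of_injOn, Finset.card_range]
    intro k hk l hl hkl
    rw [← hcard k (Nat.lt_succ_iff.1 (Finset.mem_range.1 hk)), hkl,
      hcard l (Nat.lt_succ_iff.1 (Finset.mem_range.1 hl))]
  rw [← hc]
  refine hlam.card_le_infoComplexity_of_sets hS h1 hε _ (fun T hT => ?_) fun T hT π _ hπT => ?_
  · obtain ⟨k, hk, rfl⟩ := hmem T hT
    rw [hcard k hk]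
    exact h k hk
  · have hcardT : (Finset.univ.filter fun k => π k ∈ T).card = T.card := by
      rw [← Finset.card_map (s := Finset.univ.filter fun k => π k ∈ T) π.toEmbedding]
      congr 1
      ext k
      simp [Finset.mem_map_equiv]
    obtain ⟨l, hl, h'⟩ := hmem _ hπT
    obtain ⟨k, hk, rfl⟩ := hmem T hT
    rw [← h', hcard l hl, hcard k hk] at hcardT
    rw [← h', hcardT]

/-- Admissible permutations fix the complement of `I` pointwise, so distinct subsets of it are never
identified. -/
theorem choose_le_infoComplexity
    (hlam : IsEigenvalueSequence ((ContinuousLinearMap.adjoint S).comp S) lam)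
    (hS : IsCompactOperator S) (h1 : 0 < lam 1) {d : ℕ} {I : Finset (Fin d)} {ε : ℝ} (hε : 0 ≤ ε)
    {k : ℕ} (h : ε ^ 2 < lam 1 ^ k * lam 0 ^ (d - k)) :
    (((d - I.card).choose k : ℕ) : ℕ∞) ≤ infoComplexity (symmetricProblem S I) ε := by
  classical
  have hc : (Finset.powersetCard k Iᶜ).card = (d - I.card).choose k := by
    rw [Finset.card_powersetCard, Finset.card_compl, Fintype.card_fin]
  rw [← hc]
  refine hlam.card_le_infoComplexity_of_sets hS h1 hε _ (fun T hT => ?_) fun T hT π hπ hπT => ?_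
  · rw [(Finset.mem_powersetCard.1 hT).2]
    exact h
  · ext x
    by_cases hx : x ∈ I
    · have hn : ∀ T ∈ Finset.powersetCard k Iᶜ, x ∉ T := fun T hT hxT =>
        Finset.mem_compl.1 ((Finset.mem_powersetCard.1 hT).1 hxT) hx
      exact iff_of_false (hn _ hπT) (hn _ hT)
    · simp [mem_coordPerms.1 hπ x hx]

end IsEigenvalueSequence

end Bounds

/-! ### From complexity bounds to tractability and back. -/

section Tractability

theorem memℓp_ofReal_iff {lam : ℕ → ℝ} (h : ∀ m, 0 ≤ lam m) {τ : ℝ} (hτ : 0 < τ) :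
    Memℓp lam (ENNReal.ofReal τ) ↔ Summable fun m => lam m ^ τ := by
  rw [memℓp_gen_iff (by rwa [ENNReal.toReal_ofReal hτ.le]), ENNReal.toReal_ofReal hτ.le]
  simp only [Real.norm_of_nonneg (h _)]

theorem TractabilityBound.le_of_le {N : ℝ → ℕ → ℕ∞} {C p q : ℝ} (h : TractabilityBound N C p q)
    {d : ℕ} (hd : 1 ≤ d) {ε : ℝ} (hε : 0 < ε) (hε1 : ε ≤ 1) {n : ℕ} (hn : (n : ℕ∞) ≤ N ε d) :
    (n : ℝ) ≤ C * ε ^ (-p) * (d : ℝ) ^ q := by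
  obtain ⟨m, hm, hle⟩ := h d hd ε hε hε1
  rw [hm, Nat.cast_le] at hn
  exact (Nat.cast_le.2 hn).trans hle

theorem StronglyPolynomiallyTractable.polynomiallyTractable {N : ℝ → ℕ → ℕ∞}
    (h : StronglyPolynomiallyTractable N) : PolynomiallyTractable N :=
  let ⟨C, p, hC, hp, hb⟩ := h
  ⟨C, p, 0, hC, hp, le_rfl, hb⟩

/-- A summable power of a sequence in `[0, θ]`, `θ < 1`, has a sum at most `1` if the exponent is
large. -/
theorem exists_summable_rpow_tsum_le_one {lam : ℕ → ℝ} (h0 : ∀ m, 0 ≤ lam m) {θ : ℝ}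
    (hθ0 : 0 < θ) (hθ : θ < 1) (hle : ∀ m, lam m ≤ θ) {τ : ℝ} (hτ : 0 < τ)
    (hsum : Summable fun m => lam m ^ τ) :
    ∃ σ : ℝ, 0 < σ ∧ (Summable fun m => lam m ^ σ) ∧ ∑' m, lam m ^ σ ≤ 1 := by
  set A := ∑' m, lam m ^ τ
  have hA0 : 0 ≤ A := tsum_nonneg fun m => Real.rpow_nonneg (h0 m) _
  -- Raising the exponent by `n` pulls out a factor `θ ^ n`, chosen small enough to absorb `A`.
  obtain ⟨n, hn⟩ := exists_pow_lt_of_lt_one (inv_pos.2 (by linarith : 0 < A + 1)) hθ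
  have hbound : ∀ m, lam m ^ (τ + n) ≤ θ ^ n * lam m ^ τ := fun m => by
    rw [Real.rpow_add_of_nonneg (h0 m) hτ.le (Nat.cast_nonneg n), Real.rpow_natCast, mul_comm]
    exact mul_le_mul_of_nonneg_right (pow_le_pow_left₀ (h0 m) (hle m) n)
      (Real.rpow_nonneg (h0 m) _)
  have hs : Summable fun m => lam m ^ (τ + n) :=
    Summable.of_nonneg_of_le (fun m => Real.rpow_nonneg (h0 m) _) hbound (hsum.mul_left _)
  refine ⟨τ + n, by positivity, hs, ?_⟩
  calc ∑' m, lam m ^ (τ + n) ≤ ∑' m, θ ^ n * lam m ^ τ := hs.tsum_le_tsum hbound (hsum.mul_left _)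
    _ = θ ^ n * A := by rw [tsum_mul_left]
    _ ≤ (A + 1)⁻¹ * (A + 1) := by gcongr; linarith
    _ = 1 := inv_mul_cancel₀ (by linarith)

/-- A sequence `u d ≤ d` with `u = O(g)` is bounded by a multiple of `g` plus a constant. -/
theorem exists_le_mul_add {u g : ℕ → ℝ} (hu : ∀ d, u d ≤ d) (hg : ∀ d, 1 ≤ d → 0 ≤ g d)
    (h : u =O[atTop] g) : ∃ c M : ℝ, 0 ≤ c ∧ 0 ≤ M ∧ ∀ d, 1 ≤ d → u d ≤ c * g d + M := by
  obtain ⟨c, hc, hb⟩ := h.exists_nonneg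
  obtain ⟨d₀, hd₀⟩ := eventually_atTop.1 hb.bound
  refine ⟨c, d₀, hc, Nat.cast_nonneg _, fun d hd => ?_⟩
  have hcg := mul_nonneg hc (hg d hd)
  rcases le_total d₀ d with h | h
  · have h1 := hd₀ d h
    rw [Real.norm_of_nonneg (hg d hd)] at h1
    linarith [(Real.le_norm_self (u d)).trans h1, Nat.cast_nonneg (α := ℝ) d₀]
  · linarith [hu d, Nat.cast_le (α := ℝ).2 h]

variable {H G : Type*} [NormedAddCommGroup H] [InnerProductSpace ℝ H] [CompleteSpace H]
  [NormedAddCommGroup G] [InnerProductSpace ℝ G] [CompleteSpace G]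
  {S : H →L[ℝ] G} {lam : ℕ → ℝ}

namespace IsEigenvalueSequence

/-- The eigenvalues of a tractable problem are summable to some power, by the univariate case. -/
theorem summable_of_tractabilityBound
    (hlam : IsEigenvalueSequence ((ContinuousLinearMap.adjoint S).comp S) lam)
    (hS : IsCompactOperator S) {I : ∀ d : ℕ, Finset (Fin d)} {C p q : ℝ} (hC : 0 < C) (hp : 0 < p)
    (h : TractabilityBound (fun ε d => infoComplexity (symmetricProblem S (I d)) ε) C p q) :
    Summable fun m => lam m ^ p := by
  have hk : ∀ k ε, 0 < ε → ε ≤ 1 → ε ^ 2 < lam k → (k + 1 : ℝ) ≤ C * ε ^ (-p) := by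
    intro k ε hε hε1 hlt
    have h1 := h.le_of_le le_rfl hε hε1 (hlam.succ_le_infoComplexity_one hS hε.le hlt)
    simpa using h1
  obtain ⟨k₀, hk₀⟩ := exists_nat_gt C
  have hbound : ∀ k ≥ k₀, lam k ^ p ≤ 2 ^ p * C ^ 2 * (1 / ((k : ℝ) + 1) ^ 2) := by
    intro k hkk
    rcases (hlam.nonneg k).eq_or_lt with h0 | h0
    · rw [← h0, Real.zero_rpow hp.ne']
      positivity
    have hle1 : lam k ≤ 1 := by
      by_contra! hgt
      have h1 := hk k 1 one_pos le_rfl (by simpa using hgt)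
      rw [Real.one_rpow, mul_one] at h1
      have h2 : (k₀ : ℝ) ≤ k := Nat.cast_le.2 hkk
      linarith
    have hx : 0 < lam k / 2 := by positivity
    -- Testing at ε² = λ_k/2 and squaring the resulting estimate gives λ_k^p ≤ 2^p C²/(k+1)², which
    -- is summable.
    have h1 := hk k (Real.sqrt (lam k / 2)) (Real.sqrt_pos.2 hx)
      (Real.sqrt_le_one.2 (by linarith)) (by rw [Real.sq_sqrt hx.le]; linarith)
    rw [Real.rpow_neg (Real.sqrt_nonneg _), ← div_eq_mul_inv,
      le_div_iff₀ (Real.rpow_pos_of_pos (Real.sqrt_pos.2 hx) p)] at h1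
    have h2 : (Real.sqrt (lam k / 2) ^ p) ^ 2 = lam k ^ p / 2 ^ p := by
      rw [Real.rpow_pow_comm (Real.sqrt_nonneg _), Real.sq_sqrt hx.le,
        Real.div_rpow h0.le zero_le_two]
    have h3 := pow_le_pow_left₀ (by positivity) h1 2
    rw [mul_pow, h2] at h3
    have h4 : (0 : ℝ) < 2 ^ p := by positivity
    have h5 : (0 : ℝ) < ((k : ℝ) + 1) ^ 2 := by positivity
    rw [mul_one_div, le_div_iff₀ h5]
    rw [← mul_div_assoc, div_le_iff₀ h4] at h3
    linarith
  have hs : Summable fun k : ℕ => 2 ^ p * C ^ 2 * (1 / ((k : ℝ) + 1) ^ 2) := by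
    refine Summable.mul_left _ ?_
    have h1 := (summable_nat_add_iff 1).2 (Real.summable_one_div_nat_pow.2 one_lt_two)
    simpa using h1
  refine Summable.of_norm_bounded_eventually_nat hs ?_
  filter_upwards [eventually_ge_atTop k₀] with k hkk
  rw [Real.norm_of_nonneg (Real.rpow_nonneg (hlam.nonneg k) p)]
  exact hbound k hkk

/-- A strongly polynomially tractable problem with norm at least `1` is normalized, with a simple
largest singular value. -/
theorem eq_one_and_lt_one_of_tractabilityBound
    (hlam : IsEigenvalueSequence ((ContinuousLinearMap.adjoint S).comp S) lam)
    (hS : IsCompactOperator S) (h1 : 0 < lam 1) {I : ∀ d : ℕ, Finset (Fin d)} {C p : ℝ}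
    (h : TractabilityBound (fun ε d => infoComplexity (symmetricProblem S (I d)) ε) C p 0)
    (h0 : 1 ≤ lam 0) : lam 0 = 1 ∧ lam 1 < 1 := by
  by_contra hcon
  -- At the fixed accuracy 1/2 there would be unboundedly many classes: if λ_1 ≥ 1 all products are
  -- at least 1, and otherwise λ_0 > 1, so a large `d` makes up for λ_1^K.
  have hd : ∀ K : ℕ, ∃ d : ℕ, 1 ≤ d ∧ K ≤ d ∧
      ∀ k ≤ K, (1 / 2 : ℝ) ^ 2 < lam 1 ^ k * lam 0 ^ (d - k) := by
    intro K
    rcases le_or_gt 1 (lam 1) with hl | hl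
    · refine ⟨K + 1, by omega, by omega, fun k _ => ?_⟩
      have := one_le_mul_of_one_le_of_one_le (one_le_pow₀ hl (n := k))
        (one_le_pow₀ h0 (n := K + 1 - k))
      norm_num
      linarith
    · have h0' : 1 < lam 0 := h0.lt_of_ne fun h => hcon ⟨h.symm, hl⟩
      have hK : 0 < lam 1 ^ K := by positivity
      obtain ⟨n, hn⟩ := pow_unbounded_of_one_lt (1 / lam 1 ^ K) h0'
      rw [div_lt_iff₀ hK] at hn
      refine ⟨K + n + 1, by omega, by omega, fun k hk => ?_⟩
      have h2 : lam 1 ^ K ≤ lam 1 ^ k := pow_le_pow_of_le_one h1.le hl.le hk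
      have h3 : lam 0 ^ n ≤ lam 0 ^ (K + n + 1 - k) := pow_le_pow_right₀ h0 (by omega)
      have h4 := mul_le_mul h3 h2 hK.le (by positivity)
      norm_num
      linarith
  obtain ⟨K, hK⟩ := exists_nat_gt (C * (1 / 2 : ℝ) ^ (-p))
  obtain ⟨d, hd1, hKd, hd⟩ := hd K
  have h2 := h.le_of_le hd1 (by norm_num : (0 : ℝ) < 1 / 2) (by norm_num)
    (hlam.succ_le_infoComplexity hS h1 (by norm_num) hKd hd)
  rw [Real.rpow_zero, mul_one] at h2
  push_cast at h2
  linarith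

/-- For a normalized polynomially tractable problem the number of coordinates without symmetry
conditions grows at most logarithmically. -/
theorem exists_mul_le_of_tractabilityBound
    (hlam : IsEigenvalueSequence ((ContinuousLinearMap.adjoint S).comp S) lam)
    (hS : IsCompactOperator S) (h1 : 0 < lam 1) {I : ∀ d : ℕ, Finset (Fin d)} {C p q : ℝ}
    (hC : 0 < C)
    (h : TractabilityBound (fun ε d => infoComplexity (symmetricProblem S (I d)) ε) C p q)
    (h0 : lam 0 = 1) : ∃ c D : ℝ, 0 < c ∧
      ∀ d, 1 ≤ d → c * ((d - (I d).card : ℕ) : ℝ) ≤ D + q * Real.log d := by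
  have h11 : lam 1 ≤ 1 := h0 ▸ hlam.antitone zero_le_one
  -- The accuracy will be ε = s^(k+1), so ε² = (λ_1/2)^(k+1) < λ_1^k. The exponent `k + 1` keeps
  -- this strict for k = 0.
  set s := Real.sqrt (lam 1 / 2) with hs
  have hs0 : 0 < s := Real.sqrt_pos.2 (by linarith)
  have hs2 : s ^ 2 = lam 1 / 2 := Real.sq_sqrt (by linarith)
  have hs1 : s ≤ 1 := Real.sqrt_le_one.2 (by linarith)
  set B := s ^ (-p)
  have hB0 : 0 < B := Real.rpow_pos_of_pos hs0 _
  -- With xB = 1/2 the binomial expansion of (x+1)^m is dominated by a geometric series.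
  set x := 1 / (2 * B) with hx
  have hx0 : 0 < x := by positivity
  have hchoose : ∀ d, 1 ≤ d → ∀ k : ℕ,
      ((d - (I d).card).choose k : ℝ) ≤ C * B ^ (k + 1) * (d : ℝ) ^ q := by
    intro d hd k
    have hε : (s ^ (k + 1)) ^ 2 < lam 1 ^ k * lam 0 ^ (d - k) := by
      rw [h0, one_pow, mul_one, ← pow_mul, mul_comm, pow_mul, hs2, pow_succ]
      calc (lam 1 / 2) ^ k * (lam 1 / 2) < (lam 1 / 2) ^ k * 1 := by
            gcongr
            linarith
        _ ≤ lam 1 ^ k := by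
            rw [mul_one]
            gcongr
            linarith
    have h2 := h.le_of_le hd (pow_pos hs0 (k + 1)) (pow_le_one₀ hs0.le hs1)
      (hlam.choose_le_infoComplexity hS h1 (pow_pos hs0 _).le hε)
    rwa [← Real.rpow_pow_comm hs0.le] at h2
  refine ⟨Real.log (x + 1), Real.log (2 * C * B), Real.log_pos (by linarith), fun d hd => ?_⟩
  have hd0 : (0 : ℝ) < d := by exact_mod_cast hd
  set m := d - (I d).card
  have hsum : (x + 1) ^ m ≤ 2 * C * B * (d : ℝ) ^ q := by
    have hterm : ∀ k, x ^ k * 1 ^ (m - k) * (m.choose k : ℝ) ≤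
        C * B * (d : ℝ) ^ q * (1 / 2 : ℝ) ^ k := fun k => by
      rw [one_pow, mul_one]
      calc x ^ k * (m.choose k : ℝ) ≤ x ^ k * (C * B ^ (k + 1) * (d : ℝ) ^ q) := by
            gcongr
            exact hchoose d hd k
        _ = C * B * (d : ℝ) ^ q * (x * B) ^ k := by rw [mul_pow, pow_succ]; ring
        _ = _ := by
            congr 2
            rw [hx]
            field_simp
    rw [add_pow]
    refine (Finset.sum_le_sum fun k _ => hterm k).trans ?_
    rw [← Finset.mul_sum]
    have hgeo : ∑ k ∈ Finset.range (m + 1), (1 / 2 : ℝ) ^ k ≤ 2 := sum_geometric_two_le _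
    have hpos : 0 ≤ C * B * (d : ℝ) ^ q := by positivity
    nlinarith
  have hlog := Real.log_le_log (by positivity) hsum
  rw [Real.log_pow, Real.log_mul (by positivity) (by positivity), Real.log_rpow hd0] at hlog
  linarith

theorem stronglyPolynomiallyTractable_of_lt_one
    (hlam : IsEigenvalueSequence ((ContinuousLinearMap.adjoint S).comp S) lam)
    (hS : IsCompactOperator S) (h0 : 0 < lam 0) (h1 : lam 0 < 1) {I : ∀ d : ℕ, Finset (Fin d)}
    {τ : ℝ} (hτ : 0 < τ) (hsum : Summable fun m => lam m ^ τ) :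
    StronglyPolynomiallyTractable (fun ε d => infoComplexity (symmetricProblem S (I d)) ε) := by
  obtain ⟨σ, hσ, hs, hA⟩ := exists_summable_rpow_tsum_le_one hlam.nonneg h0 h1
    (fun m => hlam.antitone (Nat.zero_le m)) hτ hsum
  refine ⟨_, 2 * σ, Real.exp_pos ((∑' m, lam m ^ σ) / (1 - lam 0 ^ σ)), by positivity,
    fun d hd ε hε hε1 => ?_⟩
  -- Here `N = 0`: no eigenvalue equals `1`, and the factor in `d + 1` has exponent `0 - 1 = 0`.
  obtain ⟨n, hn, hle⟩ := hlam.infoComplexity_le hS h0 h1.le hσ hs h1 (I d) hε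
  refine ⟨n, hn, hle.trans ?_⟩
  have hA0 : 0 ≤ ∑' m, lam m ^ σ := tsum_nonneg fun m => Real.rpow_nonneg (hlam.nonneg m) _
  rw [Real.rpow_zero, mul_one, Nat.zero_sub, pow_zero, one_mul, mul_comm]
  refine mul_le_mul_of_nonneg_left ?_ (Real.exp_pos _).le
  exact mul_le_of_le_one_right (by positivity) (pow_le_one₀ hA0 hA)

/-- The upper bound for normalized problems if the number of coordinates without symmetry
conditions is at most `c * log d + M`. -/
theorem exists_tractabilityBound
    (hlam : IsEigenvalueSequence ((ContinuousLinearMap.adjoint S).comp S) lam)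
    (hS : IsCompactOperator S) (h0 : lam 0 = 1) {I : ∀ d : ℕ, Finset (Fin d)}
    {τ : ℝ} (hτ : 0 < τ) (hsum : Summable fun m => lam m ^ τ) {N : ℕ} (hN : lam N < 1) {c M : ℝ}
    (hc : 0 ≤ c) (hM : ∀ d, 1 ≤ d → ((d - (I d).card : ℕ) : ℝ) ≤ c * Real.log d + M) :
    ∃ C q : ℝ, 0 < C ∧ 0 ≤ q ∧ (c = 0 → N = 1 → q = 0) ∧
      TractabilityBound (fun ε d => infoComplexity (symmetricProblem S (I d)) ε) C (2 * τ) q := by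
  set A := ∑' m, lam m ^ τ
  have hA0 : 0 ≤ A := tsum_nonneg fun m => Real.rpow_nonneg (hlam.nonneg m) _
  set L := Real.log (A + 1) with hL
  have hL0 : 0 ≤ L := Real.log_nonneg (by linarith)
  -- Passing from `A` to `A + 1` makes `L` nonnegative, so the bound on the free coordinates can be
  -- multiplied by it; then e^(Lc ln d) = d^(cL).
  set R := Real.exp (A / (1 - lam N ^ τ))
  have hR0 : 0 < R := Real.exp_pos _
  refine ⟨Real.exp (M * L) * (2 ^ (N - 1) * R), c * L + (N - 1 : ℕ), by positivity, by positivity,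
    fun h h' => by simp [h, h'], fun d hd ε hε hε1 => ?_⟩
  obtain ⟨n, hn, hle⟩ := hlam.infoComplexity_le hS (by linarith) h0.le hτ hsum hN (I d) hε
  refine ⟨n, hn, hle.trans ?_⟩
  have hd1 : (1 : ℝ) ≤ d := by exact_mod_cast hd
  have hd0 : (0 : ℝ) < d := by linarith
  have hpow : A ^ (d - (I d).card) ≤ Real.exp (M * L) * (d : ℝ) ^ (c * L) := by
    calc A ^ (d - (I d).card) ≤ (A + 1) ^ (d - (I d).card) :=
          pow_le_pow_left₀ hA0 (by linarith) _
      _ = Real.exp (L * (d - (I d).card : ℕ)) := by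
          rw [Real.exp_mul, hL, Real.exp_log (by linarith), Real.rpow_natCast]
      _ ≤ Real.exp (L * (c * Real.log d + M)) := by
          gcongr
          exact hM d hd
      _ = _ := by
          rw [Real.rpow_def_of_pos hd0, ← Real.exp_add]
          ring_nf
  have hd2 : (d + 1 : ℝ) ^ (N - 1) ≤ 2 ^ (N - 1) * (d : ℝ) ^ (N - 1) := by
    rw [← mul_pow]
    gcongr
    linarith
  calc ε ^ (-(2 * τ)) * A ^ (d - (I d).card) * ((d + 1 : ℝ) ^ (N - 1) * R)
      ≤ ε ^ (-(2 * τ)) * (Real.exp (M * L) * (d : ℝ) ^ (c * L)) *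
          (2 ^ (N - 1) * (d : ℝ) ^ (N - 1) * R) := by gcongr
    _ = _ := by
        rw [Real.rpow_add hd0, Real.rpow_natCast]
        ring

end IsEigenvalueSequence

end Tractability

/-! ### The two equivalences. -/

theorem theorem5p11 {H G : Type*}
    [NormedAddCommGroup H] [InnerProductSpace ℝ H] [CompleteSpace H]
    [NormedAddCommGroup G] [InnerProductSpace ℝ G] [CompleteSpace G]
    (S : H →L[ℝ] G) (hS : IsCompactOperator S)
    -- `lam m` is the eigenvalue $\lambda_{m+1}$ of `S† S`
    (lam : ℕ → ℝ) (hlam : IsEigenvalueSequence ((ContinuousLinearMap.adjoint S).comp S) lam)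
    (hlam2 : 0 < lam 1)
    (I : ∀ d : ℕ, Finset (Fin d)) (hI : ∀ d, 1 < d → (I d).Nonempty) :
    (StronglyPolynomiallyTractable (fun ε d => infoComplexity (symmetricProblem S (I d)) ε) ↔
      (∃ τ : ℝ, 0 < τ ∧ Memℓp lam (ENNReal.ofReal τ)) ∧
        (lam 0 < 1 ∨
          (1 = lam 0 ∧ lam 0 > lam 1 ∧
            (fun d : ℕ => (d : ℝ) - (I d).card) =O[atTop] fun _ => (1 : ℝ)))) ∧
    (lam 0 ≤ 1 →
      (PolynomiallyTractable (fun ε d => infoComplexity (symmetricProblem S (I d)) ε) ↔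
        (∃ τ : ℝ, 0 < τ ∧ Memℓp lam (ENNReal.ofReal τ)) ∧
          (lam 0 < 1 ∨
            (lam 0 = 1 ∧
              (fun d : ℕ => (d : ℝ) - (I d).card) =O[atTop] fun d : ℕ => Real.log d)))) := by
  have h0 : 0 < lam 0 := hlam2.trans_le (hlam.antitone zero_le_one)
  have hcast : ∀ d, ((d - (I d).card : ℕ) : ℝ) = (d : ℝ) - (I d).card := fun d =>
    Nat.cast_sub ((Finset.card_le_univ _).trans_eq (Fintype.card_fin d))
  have hled : ∀ d : ℕ, (d : ℝ) - (I d).card ≤ d := fun d => by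
    linarith [Nat.cast_nonneg (α := ℝ) (I d).card]
  have hnonneg : ∀ d : ℕ, 0 ≤ (d : ℝ) - (I d).card := fun d => by
    rw [← hcast]
    positivity
  have hlog0 : ∀ d : ℕ, 1 ≤ d → 0 ≤ Real.log d := fun d hd =>
    Real.log_nonneg (by exact_mod_cast hd)
  refine ⟨⟨?_, ?_⟩, fun hle1 => ⟨?_, ?_⟩⟩
  · rintro ⟨C, p, hC, hp, hb⟩
    refine ⟨⟨p, hp, (memℓp_ofReal_iff hlam.nonneg hp).2
      (hlam.summable_of_tractabilityBound hS hC hp hb)⟩, ?_⟩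
    rcases lt_or_ge (lam 0) 1 with hlt | hge
    · exact Or.inl hlt
    obtain ⟨heq, hlt⟩ := hlam.eq_one_and_lt_one_of_tractabilityBound hS hlam2 hb hge
    refine Or.inr ⟨heq.symm, heq ▸ hlt, ?_⟩
    obtain ⟨c, D, hc, hcD⟩ := hlam.exists_mul_le_of_tractabilityBound hS hlam2 hC hb heq
    refine IsBigO.of_bound (D / c) ?_
    filter_upwards [eventually_ge_atTop 1] with d hd
    have h1 := hcD d hd
    rw [zero_mul, add_zero, hcast] at h1
    rw [Real.norm_of_nonneg (hnonneg d), norm_one, mul_one, le_div_iff₀ hc]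
    linarith
  · rintro ⟨⟨τ, hτ, hmem⟩, hlt | ⟨heq, hlt, hO⟩⟩
    · exact hlam.stronglyPolynomiallyTractable_of_lt_one hS h0 hlt hτ
        ((memℓp_ofReal_iff hlam.nonneg hτ).1 hmem)
    · obtain ⟨c, M, -, -, hM⟩ := exists_le_mul_add hled (fun _ _ => zero_le_one) hO
      -- A bounded number of free coordinates is the logarithmic bound with coefficient `0`, and λ_1
      -- < 1 permits `N = 1`; together they force `q = 0`.
      obtain ⟨C, q, hC, -, hq, hb⟩ := hlam.exists_tractabilityBound hS heq.symm (I := I) hτ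
        ((memℓp_ofReal_iff hlam.nonneg hτ).1 hmem) (N := 1) (by linarith) (c := 0) (M := c + M)
        le_rfl fun d hd => by
          rw [hcast]
          linarith [hM d hd]
      rw [hq rfl rfl] at hb
      exact ⟨C, 2 * τ, hC, by positivity, hb⟩
  · rintro ⟨C, p, q, hC, hp, hq, hb⟩
    refine ⟨⟨p, hp, (memℓp_ofReal_iff hlam.nonneg hp).2
      (hlam.summable_of_tractabilityBound hS hC hp hb)⟩, ?_⟩
    rcases hle1.lt_or_eq with hlt | heq
    · exact Or.inl hlt
    refine Or.inr ⟨heq, ?_⟩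
    obtain ⟨c, D, hc, hcD⟩ := hlam.exists_mul_le_of_tractabilityBound hS hlam2 hC hb heq
    -- Once ln d ≥ 1, the constant `D` is absorbed into |D| ln d.
    refine IsBigO.of_bound ((|D| + q) / c) ?_
    have hlog := (Real.tendsto_log_atTop.comp tendsto_natCast_atTop_atTop).eventually_ge_atTop 1
    filter_upwards [eventually_ge_atTop 1, hlog] with d hd hd1
    have h1 := hcD d hd
    have h2 : (1 : ℝ) ≤ Real.log d := hd1
    rw [hcast] at h1
    rw [Real.norm_of_nonneg (hnonneg d), Real.norm_of_nonneg (hlog0 d hd), div_mul_eq_mul_div,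
      le_div_iff₀ hc]
    nlinarith [le_abs_self D, abs_nonneg D]
  · rintro ⟨⟨τ, hτ, hmem⟩, hlt | ⟨heq, hO⟩⟩
    · exact (hlam.stronglyPolynomiallyTractable_of_lt_one hS h0 hlt hτ
        ((memℓp_ofReal_iff hlam.nonneg hτ).1 hmem)).polynomiallyTractable
    · have hsum := (memℓp_ofReal_iff hlam.nonneg hτ).1 hmem
      obtain ⟨c, M, hc, -, hM⟩ := exists_le_mul_add hled hlog0 hO
      obtain ⟨N, hN⟩ : ∃ N, lam N < 1 := by
        obtain ⟨N, hN⟩ := (hsum.tendsto_atTop_zero.eventually (gt_mem_nhds one_pos)).exists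
        refine ⟨N, ?_⟩
        by_contra! hge
        exact hN.not_ge (Real.one_le_rpow hge hτ.le)
      obtain ⟨C, q, hC, hq, -, hb⟩ := hlam.exists_tractabilityBound hS heq (I := I) hτ hsum hN hc
        fun d hd => by
          rw [hcast]
          exact hM d hd
      exact ⟨C, 2 * τ, q, hC, by positivity, hq, hb⟩
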